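/- Conventions. Let $S_n$ be the group of permutations of $\{1,\dots,n\}$ with product $\sigma\cdot\tau=\tau\circ\sigma$. The symmetric groups operad $\mathscr S=\{S_n\}_{n\ge 0}$ has the composition $\gamma(\sigma;\tau_1,\dots,\tau_k)$ that sends the $j$-th letter of the $i$-th block (of size $m_i$) to the $\tau_i(j)$-th letter of the $\sigma(i)$-th block. A *group operad* $\mathscr G=\{G_n\}_{n\ge0}$ is a sequence of groups, with $G_0$ trivial, with homomorphisms $\pi:G_n\to S_n$ and compositions $\gamma:G_k\times G_{m_1}\times\dots\times G_{m_k}\to G_{m_1+\dots+m_k}$ that form an operad (associative, with the identity $e_1\in G_1$ as unit), such that $\pi$ is a morphism of operads and $$\gamma(aa';b_1b_1',\dots,b_kb_k')=\gamma(a;b_1,\dots,b_k)\,\gamma(a';b'_{a^{-1}(1)},\dots,b'_{a^{-1}(k)}),\qquad a(i):=\pi(a)(i).$$ A morphism of group operads is a sequence of group homomorphisms commuting with $\pi$ and $\gamma$. A sub group operad $\mathscr H=\{H_n\}\le\mathscr G$ is a sequence of subgroups $H_n\le G_n$ closed under $\gamma$; a morphism of pairs $(\mathscr G,\mathscr H)\to(\mathscr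 G',\mathscr H')$ is a morphism $\psi:\mathscr G\to\mathscr G'$ with $\psi(H_n)\subseteq H_n'$ for all $n$. For a group $G$ let $EG$ be the simplicial set with $(EG)_l=G^{l+1}$, whose faces delete and whose degeneracies repeat entries, with the left action $b\cdot(a_0,\dots,a_l)=(ba_0,\dots,ba_l)$ of $G$. For $H\le G$ let $EG/H$ be the quotient by the action of $H$, based at the vertex $H(e)$, and let $|EG|/H$ be the quotient space of the geometric realization, based at the image of the vertex $e$. The group $\pi_1(EG/H)$ consists of the homotopy classes of spherical $1$-simplices (both faces are the base point), with $[d_2s]\cdot[d_0s]=[d_1s]$ for every $2$-simplex $s$ whose faces are spherical; $\pi_1(|EG|/H)$ is the usual fundamental group, with $[f][g]$ the class of $f$ followed by $g$. The composition of $E\mathscr G=\{EG_n\}$ is $\gamma$ applied entrywise, and that of $|E\mathscr G|=\{|EG_n|\}$ is its realization, $([c;t],[a_1;t],\dots,[a_k;t])\mapsto[\gamma(c;a_1,\dots,a_k);t]$. Let $e_n$ denote also the vertex $e_n$ of $EG_n$ and of $|EG_n|$. For a sub group operad $\mathscr H\le\mathscr G$, the fundamental groups operad $\pi_1(|E\mathscr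 G|/\mathscr H)=\{\pi_1(|EG_n|/H_n)\}_{n\ge 0}$ has the following structure. A class $x\in\pi_1(|EG_n|/H_n)$ is represented by the projection of a path $f$ in $|EG_n|$ from $e_n$ to $a e_n$ with $a\in H_n$; put $\pi(x)=\pi(a)$. If $x$ (in arity $k$) and $y_i$ (in arity $m_i$) are represented by such paths $f$, from $e_k$ to $ae_k$, and $g_i$, from $e_{m_i}$ to $b_ie_{m_i}$, then $\gamma(x;y_1,\dots,y_k)$ is represented by the path $s\mapsto\gamma(f(s);g_1(s),\dots,g_k(s))$ from $e_m$ to $\gamma(a;b_1,\dots,b_k)e_m$, $m=m_1+\dots+m_k$. The fundamental groups operad $\pi_1(E\mathscr G/\mathscr H)=\{\pi_1(EG_n/H_n)\}_{n\ge0}$ is defined in the same way, with $1$-simplices of $EG_n$ from $e_n$ to $ae_n$ in place of paths. **Theorem.** For every group operad $\mathscr G$ and every sub group operad $\mathscr H\le\mathscr G$, these prescriptions define group operads $\pi_1(E\mathscr G/\mathscr H)$ and $\pi_1(|E\mathscr G|/\mathscr H)$ (in particular the composite paths are continuous), and there are isomorphisms of group operads $$\mathscr H\;\cong\;\pi_1(E\mathscr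 G/\mathscr H)\;\cong\;\pi_1(|E\mathscr G|/\mathscr H)$$ that are natural with respect to morphisms of pairs of group operads. In particular, $\mathscr G\cong\pi_1(E\mathscr G/\mathscr G)\cong\pi_1(|E\mathscr G|/\mathscr G)$ as group operads. -/

import Mathlib

universe u

/-! ## Group operads -/

/-- The symmetric group of `{1, …, n}` with the product `σ · τ = τ ∘ σ` ("first `σ`, then `τ`"). -/
abbrev SymGroup (n : ℕ) : Type := (Equiv.Perm (Fin n))ᵐᵒᵖ

/-- The block of sizes `m 0, m 1, …` (of total size `N`) containing a position `l < N`, together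
with the position inside this block. -/
def blockOf {k : ℕ} (m : Fin k → ℕ) {N : ℕ} (h : ∑ i, m i = N) (l : Fin N) :
    (i : Fin k) × Fin (m i) :=
  finSigmaFinEquiv.symm (Fin.cast h.symm l)

lemma sum_comp_perm {k : ℕ} {m : Fin k → ℕ} {N : ℕ} (h : ∑ i, m i = N)
    (p : Equiv.Perm (Fin k)) : ∑ i, m (p i) = N :=
  (Equiv.sum_comp p m).trans h

/-- The composition `γ(p; q₁, …, q_k)` of the symmetric groups operad: the `j`-th letter of the
`i`-th block (of size `m i`) goes to the `q_i(j)`-th letter of the `p(i)`-th block of the target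
(the blocks of the target have the sizes `m (p⁻¹ 0), m (p⁻¹ 1), …`). -/
def SymGroup.γ {k : ℕ} (m : Fin k → ℕ) {N : ℕ} (h : ∑ i, m i = N) (p : SymGroup k)
    (q : ∀ i, SymGroup (m i)) : SymGroup N :=
  MulOpposite.op <|
    (finCongr h.symm).trans <|
    finSigmaFinEquiv.symm.trans <|
    (Equiv.sigmaCongrRight fun i => (q i).unop).trans <|
    (Equiv.sigmaCongrLeft' p.unop).trans <|
    finSigmaFinEquiv.trans <|
    finCongr (sum_comp_perm h p.unop.symm)

/-- A group operad whose `n`-th group is `G n`. In `γ m h a b`, the argument `h : ∑ i, m i = N`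
records that the result has arity `N`. (For `k = 0` the operation `γ` is `G 0 → G 0`, which carries
no information since `G 0` is trivial.) -/
structure GroupOperad (G : ℕ → Type*) [∀ n, Group (G n)] where
  /-- `G 0` is a point. -/
  subsingleton_zero : Subsingleton (G 0)
  /-- The homomorphisms to the symmetric groups. -/
  π : ∀ n, G n →* SymGroup n
  /-- The operad composition. -/
  γ : ∀ {k : ℕ} (m : Fin k → ℕ) {N : ℕ}, ∑ i, m i = N → G k → (∀ i, G (m i)) → G N
  assoc : ∀ {k : ℕ} (m : Fin k → ℕ) {M : ℕ} (hm : ∑ i, m i = M)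
    (n : ∀ i, Fin (m i) → ℕ) (n' : Fin k → ℕ) (hn : ∀ i, ∑ j, n i j = n' i)
    {N : ℕ} (hn' : ∑ i, n' i = N)
    (hN : ∑ l : Fin M, n (blockOf m hm l).1 (blockOf m hm l).2 = N)
    (a : G k) (b : ∀ i, G (m i)) (c : ∀ i j, G (n i j)),
    γ (fun l : Fin M => n (blockOf m hm l).1 (blockOf m hm l).2) hN (γ m hm a b)
        (fun l => c (blockOf m hm l).1 (blockOf m hm l).2) =
      γ n' hn' a (fun i => γ (n i) (hn i) (b i) (c i))
  one_γ : ∀ {n : ℕ} (h : ∑ _i : Fin 1, n = n) (a : G n), γ (fun _ => n) h 1 (fun _ => a) = a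
  γ_one : ∀ {n : ℕ} (h : ∑ _i : Fin n, 1 = n) (a : G n), γ (fun _ => 1) h a (fun _ => 1) = a
  /-- `π` is a morphism of operads. -/
  π_γ : ∀ {k : ℕ} (m : Fin k → ℕ) {N : ℕ} (h : ∑ i, m i = N) (a : G k) (b : ∀ i, G (m i)),
    π N (γ m h a b) = SymGroup.γ m h (π k a) (fun i => π (m i) (b i))
  /-- `γ` is a crossed homomorphism:
  `γ(aa'; b₁b₁', …, b_kb_k') = γ(a; b₁, …, b_k) γ(a'; b'_{a⁻¹(1)}, …, b'_{a⁻¹(k)})`. -/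
  crossed : ∀ {k : ℕ} (m : Fin k → ℕ) {N : ℕ} (h : ∑ i, m i = N) (a a' : G k)
    (b b' : ∀ i, G (m i)),
    γ m h (a * a') (fun i => b i * b' i) =
      γ m h a b *
        γ (fun i => m ((π k a).unop.symm i)) (sum_comp_perm h (π k a).unop.symm) a'
          (fun i => b' ((π k a).unop.symm i))

/-- Morphisms of group operads. -/
structure GroupOperad.Hom {G : ℕ → Type*} [∀ n, Group (G n)] (𝒢 : GroupOperad G)
    {G' : ℕ → Type*} [∀ n, Group (G' n)] (𝒢' : GroupOperad G') where
  app : ∀ n, G n →* G' n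
  map_π : ∀ n (a : G n), 𝒢'.π n (app n a) = 𝒢.π n a
  map_γ : ∀ {k : ℕ} (m : Fin k → ℕ) {N : ℕ} (h : ∑ i, m i = N) (a : G k) (b : ∀ i, G (m i)),
    app N (𝒢.γ m h a b) = 𝒢'.γ m h (app k a) (fun i => app (m i) (b i))

/-- Isomorphisms of group operads: morphisms that are bijective in each arity. -/
structure GroupOperad.Iso {G : ℕ → Type*} [∀ n, Group (G n)] (𝒢 : GroupOperad G)
    {G' : ℕ → Type*} [∀ n, Group (G' n)] (𝒢' : GroupOperad G') extends GroupOperad.Hom 𝒢 𝒢' where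
  bijective : ∀ n, Function.Bijective (app n)

/-- Sub group operads. -/
structure SubGroupOperad {G : ℕ → Type*} [∀ n, Group (G n)] (𝒢 : GroupOperad G) where
  H : ∀ n, Subgroup (G n)
  γ_mem : ∀ {k : ℕ} (m : Fin k → ℕ) {N : ℕ} (h : ∑ i, m i = N) {a : G k} {b : ∀ i, G (m i)},
    a ∈ H k → (∀ i, b i ∈ H (m i)) → 𝒢.γ m h a b ∈ H N

namespace SubGroupOperad

variable {G : ℕ → Type*} [∀ n, Group (G n)] {𝒢 : GroupOperad G}

/-- A sub group operad is a group operad with the restrictions of `π` and `γ`. -/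
def toGroupOperad (𝓗 : SubGroupOperad 𝒢) : GroupOperad (fun n => 𝓗.H n) where
  subsingleton_zero := by
    have := 𝒢.subsingleton_zero
    infer_instance
  π n := (𝒢.π n).comp (𝓗.H n).subtype
  γ m _ h a b := ⟨𝒢.γ m h a.1 (fun i => (b i).1), 𝓗.γ_mem m h a.2 (fun i => (b i).2)⟩
  assoc m _ hm n n' hn _ hn' hN a b c :=
    Subtype.ext (𝒢.assoc m hm n n' hn hn' hN a.1 (fun i => (b i).1) (fun i j => (c i j).1))
  one_γ h a := Subtype.ext (𝒢.one_γ h a.1)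
  γ_one h a := Subtype.ext (𝒢.γ_one h a.1)
  π_γ m _ h a b := 𝒢.π_γ m h a.1 (fun i => (b i).1)
  crossed m _ h a a' b b' :=
    Subtype.ext (𝒢.crossed m h a.1 a'.1 (fun i => (b i).1) (fun i => (b' i).1))

/-- `𝒢` as a sub group operad of itself. -/
def whole (𝒢 : GroupOperad G) : SubGroupOperad 𝒢 where
  H _ := ⊤
  γ_mem _ _ _ _ _ _ _ := Subgroup.mem_top _

end SubGroupOperad

/-- `ψ` is a morphism of pairs `(𝒢, 𝓗) → (𝒢', 𝓗')`. -/
def GroupOperad.Hom.MapsPair {G : ℕ → Type*} [∀ n, Group (G n)] {𝒢 : GroupOperad G}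
    {G' : ℕ → Type*} [∀ n, Group (G' n)] {𝒢' : GroupOperad G'} (ψ : GroupOperad.Hom 𝒢 𝒢')
    (𝓗 : SubGroupOperad 𝒢) (𝓗' : SubGroupOperad 𝒢') : Prop :=
  ∀ n, ∀ a ∈ 𝓗.H n, ψ.app n a ∈ 𝓗'.H n

section Homotopy

open CategoryTheory Simplicial
open scoped unitInterval

/-! ## The fundamental group of a pointed simplicial set -/

namespace SSet

variable {X Y : SSet.{u}}

/-- Homotopy of spherical `1`-simplices (edges both of whose faces are the base point). -/
def LoopHomotopic {x : X _⦋0⦌} (e f : X.Edge x x) : Prop :=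
  Nonempty (Edge.CompStruct e (Edge.id x) f)

/-- The set of homotopy classes of spherical `1`-simplices. -/
def LoopClasses (X : SSet.{u}) (x : X _⦋0⦌) : Type u :=
  Quot (LoopHomotopic (x := x))

/-- The relation `w = u v` on homotopy classes of spherical `1`-simplices: there is a `2`-simplex
whose faces `d₂`, `d₀`, `d₁` represent `u`, `v`, `w`. -/
def LoopClasses.IsProduct {x : X _⦋0⦌} (u v w : LoopClasses X x) : Prop :=
  ∃ e f g : X.Edge x x, Quot.mk _ e = u ∧ Quot.mk _ f = v ∧ Quot.mk _ g = w ∧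
    Nonempty (Edge.CompStruct e f g)

/-- The map induced by a pointed simplicial map. -/
def LoopClasses.map (φ : X ⟶ Y) {x : X _⦋0⦌} {y : Y _⦋0⦌} (h : φ.app _ x = y) :
    LoopClasses X x → LoopClasses Y y :=
  Quot.map (fun e => (e.map φ).ofEq h h) (by
    subst h
    rintro e f ⟨s⟩
    refine ⟨Edge.CompStruct.mk (s.map φ).simplex ?_ ?_ ?_⟩
    · exact (s.map φ).d₂
    · exact (s.map φ).d₀.trans (congrArg Edge.edge (Edge.map_id x φ))
    · exact (s.map φ).d₁)

end SSet

/-! ## The simplicial set `EG` and its quotients -/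

section EG

variable (G : Type u) [Group G]

/-- The simplicial set `EG`, with `(EG)_k = G^{k+1}`. -/
def EG : SSet.{u} where
  obj n := Fin (n.unop.len + 1) → G
  map f := ↾fun s => s ∘ f.unop.toOrderHom
  map_id _ := rfl
  map_comp _ _ := rfl

/-- The vertex `e` of `EG`. -/
def EG.base : (EG G) _⦋0⦌ := fun _ : Fin 1 => (1 : G)

variable {G}

/-- The map `EG → EG'` induced by a homomorphism. -/
def EG.map {G' : Type u} [Group G'] (φ : G →* G') : EG G ⟶ EG G' where
  app n := ↾fun (s : Fin (n.unop.len + 1) → G) => fun i => φ (s i)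
  naturality _ _ _ := rfl

/-- The action `g · (a₀, …, a_k) = (g a₀, …, g a_k)` on `EG`. -/
def EG.smul (g : G) : EG G ⟶ EG G where
  app n := ↾fun (s : Fin (n.unop.len + 1) → G) => fun i => g * s i
  naturality _ _ _ := rfl

/-- The quotient `EG/H` modulo the left action of `H`. -/
def EGmod (H : Subgroup G) : SSet.{u} where
  obj n := Quotient (MulAction.orbitRel H (Fin (n.unop.len + 1) → G))
  map f := ↾Quotient.map' (fun s => s ∘ f.unop.toOrderHom) (by
    rintro _ s ⟨h, rfl⟩
    exact ⟨h, rfl⟩)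
  map_id n := by
    ext s
    induction s using Quotient.inductionOn
    rfl
  map_comp f g := by
    ext s
    induction s using Quotient.inductionOn
    rfl

/-- The projection `EG → EG/H`. -/
def EGmod.proj (H : Subgroup G) : EG G ⟶ EGmod H where
  app n := ↾fun (s : Fin (n.unop.len + 1) → G) =>
    (Quotient.mk (MulAction.orbitRel H (Fin (n.unop.len + 1) → G)) s)
  naturality _ _ _ := rfl

/-- The base point `H(e)` of `EG/H`. -/
def EGmod.base (H : Subgroup G) : (EGmod H) _⦋0⦌ := (EGmod.proj H).app _ (EG.base G)

/-- The map `EG/H → EG'/H'` induced by a homomorphism of pairs of groups. -/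
def EGmod.map {G' : Type u} [Group G'] {H : Subgroup G} {H' : Subgroup G'} (φ : G →* G')
    (hφ : ∀ a ∈ H, φ a ∈ H') : EGmod H ⟶ EGmod H' where
  app n := ↾Quotient.map' (fun (s : Fin (n.unop.len + 1) → G) => fun i => φ (s i)) (by
    rintro _ s ⟨h, rfl⟩
    exact ⟨⟨φ h, hφ h h.2⟩, by ext i; exact (map_mul φ (h : G) (s i)).symm⟩)
  naturality n m f := by
    ext s
    induction s using Quotient.inductionOn
    rfl

lemma EGmod.map_base {G' : Type u} [Group G'] {H : Subgroup G} {H' : Subgroup G'} (φ : G →* G')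
    (hφ : ∀ a ∈ H, φ a ∈ H') : (EGmod.map φ hφ).app _ (EGmod.base H) = EGmod.base H' :=
  congrArg (Quotient.mk (MulAction.orbitRel H' (Fin 1 → G'))) (funext fun _ => map_one φ)

lemma EGmod.proj_smul_base (H : Subgroup G) (a : H) :
    (EGmod.proj H).app _ ((EG.smul (a : G)).app _ (EG.base G)) = EGmod.base H :=
  Quotient.sound (s := MulAction.orbitRel H (Fin 1 → G)) ⟨a, rfl⟩

/-- The fundamental group `π₁(EG/H)` of the (Kan) simplicial set `EG/H`. -/
abbrev SimplicialPi1 (H : Subgroup G) : Type u := (EGmod H).LoopClasses (EGmod.base H)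

end EG

section SimplicialPi1Group

variable {G : Type u} [Group G] (H : Subgroup G)

namespace SimplicialPi1

/-- The invariant `a⁻¹ b` of a `1`-simplex `H(a, b)` of `EG/H`. -/
def label : (EGmod H) _⦋1⦌ → G :=
  Quotient.lift (s := MulAction.orbitRel H (Fin 2 → G)) (fun s => (s 0)⁻¹ * s 1) (by
    rintro _ s ⟨h, rfl⟩
    change ((h : G) * s 0)⁻¹ * ((h : G) * s 1) = _
    group)

variable {H}

lemma label_mul {e f g : (EGmod H).Edge (EGmod.base H) (EGmod.base H)}
    (c : SSet.Edge.CompStruct e f g) :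
    label H g.edge = label H e.edge * label H f.edge := by
  rw [← c.d₀, ← c.d₁, ← c.d₂]
  obtain ⟨s, hs⟩ := Quotient.exists_rep (s := MulAction.orbitRel H (Fin 3 → G)) c.simplex
  rw [← hs]
  change (s 0)⁻¹ * s 2 = ((s 0)⁻¹ * s 1) * ((s 1)⁻¹ * s 2)
  group

lemma label_id : label H (SSet.Edge.id (EGmod.base H)).edge = 1 := by
  change (1 : G)⁻¹ * 1 = 1
  simp

lemma exists_edge {a : G} (ha : a ∈ H) :
    ∃ e : (EGmod H).Edge (EGmod.base H) (EGmod.base H), label H e.edge = a := by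
  refine ⟨SSet.Edge.mk (Quotient.mk (MulAction.orbitRel H (Fin 2 → G)) ![1, a]) ?_ ?_, ?_⟩
  · refine congrArg (Quotient.mk (MulAction.orbitRel H (Fin 1 → G))) ?_
    funext i
    fin_cases i
    rfl
  · refine Quotient.sound (s := MulAction.orbitRel H (Fin 1 → G)) ⟨⟨a, ha⟩, ?_⟩
    funext i
    fin_cases i
    exact mul_one a
  · change (1 : G)⁻¹ * a = a
    simp

lemma exists_rep (e : (EGmod H).Edge (EGmod.base H) (EGmod.base H)) :
    label H e.edge ∈ H ∧
      e.edge = Quotient.mk (MulAction.orbitRel H (Fin 2 → G)) ![1, label H e.edge] := by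
  have h0 := e.src_eq
  have h1 := e.tgt_eq
  generalize e.edge = x at h0 h1 ⊢
  obtain ⟨s, rfl⟩ := Quotient.exists_rep (s := MulAction.orbitRel H (Fin 2 → G)) x
  obtain ⟨a, ha⟩ := Quotient.exact (s := MulAction.orbitRel H (Fin 1 → G)) h0
  obtain ⟨b, hb⟩ := Quotient.exact (s := MulAction.orbitRel H (Fin 1 → G)) h1
  have ha' : (a : G) * 1 = s 0 := congrFun ha 0
  have hb' : (b : G) * 1 = s 1 := congrFun hb 0
  rw [mul_one] at ha' hb'
  refine ⟨?_, Quotient.sound (s := MulAction.orbitRel H (Fin 2 → G)) ⟨a, ?_⟩⟩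
  · change (s 0)⁻¹ * s 1 ∈ H
    rw [← ha', ← hb']
    exact H.mul_mem (H.inv_mem a.2) b.2
  · funext i
    fin_cases i
    · change (a : G) * 1 = s 0
      rw [mul_one, ha']
    · change (a : G) * ((s 0)⁻¹ * s 1) = s 1
      rw [ha']
      group

lemma edge_ext {e f : (EGmod H).Edge (EGmod.base H) (EGmod.base H)}
    (h : label H e.edge = label H f.edge) : e = f :=
  SSet.Edge.ext (by rw [(exists_rep e).2, (exists_rep f).2, h])

lemma exists_compStruct {e f g : (EGmod H).Edge (EGmod.base H) (EGmod.base H)}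
    (h : label H g.edge = label H e.edge * label H f.edge) :
    Nonempty (SSet.Edge.CompStruct e f g) := by
  obtain ⟨he, he'⟩ := exists_rep e
  obtain ⟨hf, hf'⟩ := exists_rep f
  obtain ⟨hg, hg'⟩ := exists_rep g
  refine ⟨SSet.Edge.CompStruct.mk (Quotient.mk (MulAction.orbitRel H (Fin 3 → G))
    ![1, label H e.edge, label H g.edge]) ?_ ?_ ?_⟩
  · refine Eq.trans (congrArg (Quotient.mk (MulAction.orbitRel H (Fin 2 → G))) ?_) he'.symm
    funext i
    fin_cases i <;> rfl
  · refine Eq.trans (Quotient.sound (s := MulAction.orbitRel H (Fin 2 → G)) ⟨⟨_, he⟩, ?_⟩) hf'.symm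
    funext i
    fin_cases i
    · exact mul_one _
    · exact h.symm
  · refine Eq.trans (congrArg (Quotient.mk (MulAction.orbitRel H (Fin 2 → G))) ?_) hg'.symm
    funext i
    fin_cases i <;> rfl

variable (H) in
/-- The invariant of a homotopy class. -/
def classLabel : SimplicialPi1 H → G :=
  Quot.lift (fun e => label H e.edge) (by
    rintro e f ⟨c⟩
    have h := label_mul c
    rw [label_id, mul_one] at h
    exact h.symm)

lemma classLabel_injective : Function.Injective (classLabel H) := by
  rintro ⟨e⟩ ⟨f⟩ h
  exact congrArg (Quot.mk _) (edge_ext h)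

lemma classLabel_mem (u : SimplicialPi1 H) : classLabel H u ∈ H := by
  obtain ⟨e⟩ := u
  exact (exists_rep e).1

lemma exists_class {a : G} (ha : a ∈ H) : ∃ u : SimplicialPi1 H, classLabel H u = a := by
  obtain ⟨e, he⟩ := exists_edge ha
  exact ⟨Quot.mk _ e, he⟩

lemma isProduct_iff {u v w : SimplicialPi1 H} :
    SSet.LoopClasses.IsProduct u v w ↔ classLabel H w = classLabel H u * classLabel H v := by
  constructor
  · rintro ⟨e, f, g, rfl, rfl, rfl, ⟨c⟩⟩
    exact label_mul c
  · intro h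
    obtain ⟨e⟩ := u
    obtain ⟨f⟩ := v
    obtain ⟨g⟩ := w
    exact ⟨e, f, g, rfl, rfl, rfl, exists_compStruct h⟩

lemma existsUnique_product (u v : SimplicialPi1 H) :
    ∃! w, SSet.LoopClasses.IsProduct u v w := by
  obtain ⟨w, hw⟩ := exists_class (H.mul_mem (classLabel_mem u) (classLabel_mem v))
  exact ⟨w, isProduct_iff.2 hw, fun w' h => classLabel_injective
    ((isProduct_iff.1 h).trans hw.symm)⟩

lemma exists_leftInverse (u : SimplicialPi1 H) :
    ∃ v, SSet.LoopClasses.IsProduct v u (Quot.mk _ (SSet.Edge.id (EGmod.base H))) := by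
  obtain ⟨v, hv⟩ := exists_class (H.inv_mem (classLabel_mem u))
  refine ⟨v, isProduct_iff.2 ?_⟩
  rw [hv, inv_mul_cancel]
  exact label_id (H := H)

/-- The product in `π₁(EG/H)`: `[d₂ s] · [d₀ s] = [d₁ s]` for every `2`-simplex `s` of `EG/H` with
spherical faces. -/
noncomputable instance : Mul (SimplicialPi1 H) := ⟨fun u v => (existsUnique_product u v).choose⟩

/-- The unit is the class of the degenerate `1`-simplex at the base point. -/
instance : One (SimplicialPi1 H) := ⟨Quot.mk _ (SSet.Edge.id (EGmod.base H))⟩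

noncomputable instance : Inv (SimplicialPi1 H) := ⟨fun u => (exists_leftInverse u).choose⟩

lemma classLabel_mul (u v : SimplicialPi1 H) :
    classLabel H (u * v) = classLabel H u * classLabel H v :=
  isProduct_iff.1 (existsUnique_product u v).choose_spec.1

lemma classLabel_inv_mul (u : SimplicialPi1 H) : u⁻¹ * u = 1 :=
  classLabel_injective ((classLabel_mul _ _).trans
    (isProduct_iff.1 (exists_leftInverse u).choose_spec).symm)

noncomputable instance : Group (SimplicialPi1 H) :=
  Group.ofLeftAxioms
    (fun u v w => classLabel_injective (by simp only [classLabel_mul, mul_assoc]))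
    (fun u => classLabel_injective (by
      rw [classLabel_mul, show classLabel H 1 = 1 from label_id (H := H), one_mul]))
    classLabel_inv_mul

end SimplicialPi1

variable {H}

/-- A `1`-simplex of `EG` from `e` to `a e`, with `a ∈ H`, projects to a spherical `1`-simplex of
`EG/H`; this is its class in `π₁(EG/H)`. -/
def SimplicialPi1.ofLift (a : H)
    (f : (EG G).Edge (EG.base G) ((EG.smul (a : G)).app _ (EG.base G))) : SimplicialPi1 H :=
  Quot.mk _ ((f.map (EGmod.proj H)).ofEq rfl (EGmod.proj_smul_base H a))

end SimplicialPi1Group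

/-! ## The realization `|EG|` and its quotients -/

section Realization

/-- The point `[s; t]` of the geometric realization of a simplicial set, for an `n`-simplex `s` and
a point `t` of the topological `n`-simplex. -/
noncomputable def SSet.point {X : SSet.{u}} {n : ℕ} (s : X _⦋n⦌)
    (t : _root_.stdSimplex ℝ (Fin (n + 1))) : SSet.toTop.obj X :=
  TopCat.toSSetObjEquiv (SSet.toTop.obj X) (Opposite.op ⦋n⦌)
    ((sSetTopAdj.unit.app X).app (Opposite.op ⦋n⦌) s) t

variable (G : Type u) [Group G]

/-- The geometric realization `|EG|`. -/
noncomputable abbrev RealE : TopCat.{u} := SSet.toTop.obj (EG G)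

/-- The vertex `e` of `|EG|`. -/
noncomputable def RealE.base : RealE G := SSet.point (n := 0) (EG.base G) (_root_.stdSimplex.vertex 0)

variable {G}

/-- The action of `G` on `|EG|`. -/
noncomputable instance RealE.mulAction : MulAction G (RealE G) where
  smul g p := SSet.toTop.map (EG.smul g) p
  one_smul p := by
    change SSet.toTop.map (EG.smul (1 : G)) p = p
    have h : EG.smul (1 : G) = 𝟙 (EG G) := by
      ext n s
      exact funext fun i => one_mul (s i)
    rw [h, SSet.toTop.map_id]
    rfl
  mul_smul g g' p := by
    change SSet.toTop.map (EG.smul (g * g')) p =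
      SSet.toTop.map (EG.smul g) (SSet.toTop.map (EG.smul g') p)
    have h : EG.smul (g * g') = EG.smul g' ≫ EG.smul g := by
      ext n s
      exact funext fun i => mul_assoc g g' (s i)
    rw [h, SSet.toTop.map_comp]
    rfl

/-- The quotient space `|EG|/H`. -/
abbrev RealEmod (H : Subgroup G) : Type u := Quotient (MulAction.orbitRel H (RealE G))

/-- The projection `|EG| → |EG|/H`. -/
noncomputable def RealEmod.proj (H : Subgroup G) : C(RealE G, RealEmod H) :=
  ⟨Quotient.mk (MulAction.orbitRel H (RealE G)), continuous_quotient_mk'⟩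

/-- The base point of `|EG|/H`. -/
noncomputable def RealEmod.base (H : Subgroup G) : RealEmod H := RealEmod.proj H (RealE.base G)

lemma RealEmod.proj_smul_base (H : Subgroup G) (a : H) :
    RealEmod.base H = RealEmod.proj H ((a : G) • RealE.base G) :=
  (Quotient.sound (s := MulAction.orbitRel H (RealE G)) ⟨a, rfl⟩).symm

lemma RealE.map_smul {G' : Type u} [Group G'] (φ : G →* G') (g : G) (p : RealE G) :
    SSet.toTop.map (EG.map φ) (g • p) = φ g • SSet.toTop.map (EG.map φ) p := by
  change SSet.toTop.map (EG.map φ) (SSet.toTop.map (EG.smul g) p) =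
    SSet.toTop.map (EG.smul (φ g)) (SSet.toTop.map (EG.map φ) p)
  have h : EG.smul g ≫ EG.map φ = EG.map φ ≫ EG.smul (φ g) := by
    ext n s
    exact funext fun i => map_mul φ g (s i)
  have h' := congrArg SSet.toTop.map h
  rw [SSet.toTop.map_comp, SSet.toTop.map_comp] at h'
  exact congrArg (fun k => k p) h'

/-- The map `|EG|/H → |EG'|/H'` induced by a homomorphism of pairs of groups. -/
noncomputable def RealEmod.map {G' : Type u} [Group G'] {H : Subgroup G} {H' : Subgroup G'}
    (φ : G →* G') (hφ : ∀ a ∈ H, φ a ∈ H') : C(RealEmod H, RealEmod H') where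
  toFun := Quotient.map' (fun p => SSet.toTop.map (EG.map φ) p) (by
    rintro _ p ⟨h, rfl⟩
    exact ⟨⟨φ h, hφ h h.2⟩, (RealE.map_smul φ h p).symm⟩)
  continuous_toFun :=
    Continuous.quotient_map' (SSet.toTop.map (EG.map φ)).hom.continuous _

lemma SSet.map_point {X Y : SSet.{u}} (f : X ⟶ Y) {n : ℕ} (s : X _⦋n⦌)
    (t : _root_.stdSimplex ℝ (Fin (n + 1))) :
    SSet.toTop.map f (SSet.point s t) = SSet.point (f.app _ s) t := by
  have h := congrArg (fun k => k.app (Opposite.op ⦋n⦌) s) (sSetTopAdj.unit.naturality f)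
  change (sSetTopAdj.unit.app Y).app (Opposite.op ⦋n⦌) (f.app (Opposite.op ⦋n⦌) s) = _ at h
  unfold SSet.point
  rw [h]
  rfl

lemma RealEmod.map_base {G' : Type u} [Group G'] {H : Subgroup G} {H' : Subgroup G'}
    (φ : G →* G') (hφ : ∀ a ∈ H, φ a ∈ H') :
    RealEmod.map φ hφ (RealEmod.base H) = RealEmod.base H' := by
  refine congrArg (Quotient.mk (MulAction.orbitRel H' (RealE G'))) ?_
  refine (SSet.map_point (EG.map φ) (EG.base G) (_root_.stdSimplex.vertex 0)).trans ?_
  refine congrArg (fun s => SSet.point (X := EG G') (n := 0) s (_root_.stdSimplex.vertex 0)) ?_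
  exact funext fun _ => map_one φ

/-- The fundamental group `π₁(|EG|/H)`, with the product `[f][g] = [f · g]` given by the path `f`
followed by the path `g`. (The product of `FundamentalGroup` is in the opposite order.) -/
abbrev RealPi1 (H : Subgroup G) : Type u := (FundamentalGroup (RealEmod H) (RealEmod.base H))ᵐᵒᵖ

/-- A path in `|EG|` from `e` to `a e`, with `a ∈ H`, projects to a loop in `|EG|/H`; this is its
class in `π₁(|EG|/H)`. -/
noncomputable def RealPi1.ofLift {H : Subgroup G} (a : H)
    (f : Path (RealE.base G) ((a : G) • RealE.base G)) : RealPi1 H :=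
  MulOpposite.op <| FundamentalGroup.fromPath <| Path.Homotopic.Quotient.mk <|
    (f.map (RealEmod.proj H).continuous).cast rfl (RealEmod.proj_smul_base H a)

end Realization

section FundamentalGroupOperads

/-- The map `π₁(EG/H) → π₁(EG'/H')` induced by a homomorphism of pairs of groups. -/
def SimplicialPi1.map {G G' : Type u} [Group G] [Group G'] {H : Subgroup G} {H' : Subgroup G'}
    (φ : G →* G') (hφ : ∀ a ∈ H, φ a ∈ H') : SimplicialPi1 H → SimplicialPi1 H' :=
  SSet.LoopClasses.map (EGmod.map φ hφ) (EGmod.map_base φ hφ)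

/-- The map `π₁(|EG|/H) → π₁(|EG'|/H')` induced by a homomorphism of pairs of groups. -/
noncomputable def RealPi1.map {G G' : Type u} [Group G] [Group G'] {H : Subgroup G}
    {H' : Subgroup G'} (φ : G →* G') (hφ : ∀ a ∈ H, φ a ∈ H') : RealPi1 H →* RealPi1 H' :=
  MonoidHom.op (FundamentalGroup.mapOfEq (RealEmod.map φ hφ) (RealEmod.map_base φ hφ))

variable {G : ℕ → Type u} [∀ n, Group (G n)]

/-- The composition of the simplicial operad `E𝒢`:
`γ((c₀, …, c_l); (a₁₀, …, a₁ₗ), …) = (γ(c₀; a₁₀, …, a_k₀), …, γ(c_l; a₁ₗ, …, a_kl))`. -/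
def GroupOperad.simplexγ (𝒢 : GroupOperad G) {k : ℕ} (m : Fin k → ℕ) {N : ℕ}
    (h : ∑ i, m i = N) {l : ℕ} (c : (EG (G k)) _⦋l⦌) (a : ∀ i, (EG (G (m i))) _⦋l⦌) :
    (EG (G N)) _⦋l⦌ :=
  fun j : Fin (l + 1) => 𝒢.γ m h (c j) (fun i => a i j)

/-- The graph of the composition of the topological operad `|E𝒢|`: the map
`|EG_k| × |EG_{m₁}| × ⋯ × |EG_{m_k}| → |EG_N|`, the realization of the composition of `E𝒢`,
is given by `([c; t], [a₁; t], …, [a_k; t]) ↦ [γ(c; a₁, …, a_k); t]` (every point of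
the product is of the form `([c; t], [a₁; t], …, [a_k; t])` for simplices `c, a₁, …, a_k` of the same
dimension and one point `t` of the topological simplex). -/
def GroupOperad.IsRealγ (𝒢 : GroupOperad G) {k : ℕ} (m : Fin k → ℕ) {N : ℕ}
    (h : ∑ i, m i = N) (p : RealE (G k)) (q : ∀ i, RealE (G (m i))) (r : RealE (G N)) : Prop :=
  ∃ (l : ℕ) (t : _root_.stdSimplex ℝ (Fin (l + 1))) (c : (EG (G k)) _⦋l⦌)
    (a : ∀ i, (EG (G (m i))) _⦋l⦌),
    p = SSet.point c t ∧ (∀ i, q i = SSet.point (a i) t) ∧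
      r = SSet.point (𝒢.simplexγ m h c a) t

/-- `P` is the operad structure of the fundamental groups operad `π₁(E𝒢/𝓗)`: lift the spherical
`1`-simplices of `EG_n/H_n` to `1`-simplices of `EG_n` starting at `e_n` and ending at `a e_n` with
`a ∈ H_n`. Then `π` is `π(a)`, and `γ` is the class of the composite `γ` of the lifts. -/
structure IsSimplicialPi1Operad {𝒢 : GroupOperad G} (𝓗 : SubGroupOperad 𝒢)
    (P : GroupOperad (fun n => SimplicialPi1 (𝓗.H n))) : Prop where
  π_ofLift : ∀ (n : ℕ) (a : 𝓗.H n)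
    (f : (EG (G n)).Edge (EG.base (G n)) ((EG.smul (a : G n)).app _ (EG.base (G n)))),
    P.π n (SimplicialPi1.ofLift a f) = 𝒢.π n a
  γ_ofLift : ∀ {k : ℕ} (m : Fin k → ℕ) {N : ℕ} (h : ∑ i, m i = N)
    (a : 𝓗.H k) (b : ∀ i, 𝓗.H (m i))
    (f : (EG (G k)).Edge (EG.base (G k)) ((EG.smul (a : G k)).app _ (EG.base (G k))))
    (g : ∀ i, (EG (G (m i))).Edge (EG.base (G (m i)))
      ((EG.smul (b i : G (m i))).app _ (EG.base (G (m i))))),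
    ∃ w : (EG (G N)).Edge (EG.base (G N))
        ((EG.smul (𝓗.toGroupOperad.γ m h a b : G N)).app _ (EG.base (G N))),
      w.edge = 𝒢.simplexγ m h f.edge (fun i => (g i).edge) ∧
      P.γ m h (SimplicialPi1.ofLift a f) (fun i => SimplicialPi1.ofLift (b i) (g i)) =
        SimplicialPi1.ofLift (𝓗.toGroupOperad.γ m h a b) w

/-- `Q` is the operad structure of the fundamental groups operad `π₁(|E𝒢|/𝓗)`: lift the loops of
`|EG_n|/H_n` to paths in `|EG_n|` from `e_n` to `a e_n` with `a ∈ H_n`. Then `π` is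
`π(a)`, and `γ` is the class of the composite path `s ↦ γ(f(s); g₁(s), …, g_k(s))` of the lifts,
which is a path from `e_N = γ(e_k; e_{m₁}, …, e_{m_k})` to `γ(a; b₁, …, b_k) e_N`. -/
structure IsRealPi1Operad {𝒢 : GroupOperad G} (𝓗 : SubGroupOperad 𝒢)
    (Q : GroupOperad (fun n => RealPi1 (𝓗.H n))) : Prop where
  π_ofLift : ∀ (n : ℕ) (a : 𝓗.H n)
    (f : Path (RealE.base (G n)) ((a : G n) • RealE.base (G n))),
    Q.π n (RealPi1.ofLift a f) = 𝒢.π n a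
  γ_ofLift : ∀ {k : ℕ} (m : Fin k → ℕ) {N : ℕ} (h : ∑ i, m i = N)
    (a : 𝓗.H k) (b : ∀ i, 𝓗.H (m i))
    (f : Path (RealE.base (G k)) ((a : G k) • RealE.base (G k)))
    (g : ∀ i, Path (RealE.base (G (m i))) ((b i : G (m i)) • RealE.base (G (m i)))),
    ∃ w : Path (RealE.base (G N)) ((𝓗.toGroupOperad.γ m h a b : G N) • RealE.base (G N)),
      (∀ s : I, 𝒢.IsRealγ m h (f s) (fun i => g i s) (w s)) ∧
      Q.γ m h (RealPi1.ofLift a f) (fun i => RealPi1.ofLift (b i) (g i)) =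
        RealPi1.ofLift (𝓗.toGroupOperad.γ m h a b) w

end FundamentalGroupOperads

end Homotopy

/-!
A point of `|EA|` is a step function `(0, 1] → A` with finitely many steps: `[a₀, …, aₙ; t]` takes
the value `aᵢ` on the `i`-th of the consecutive intervals of lengths `t₀, …, tₙ`. Two step functions
have a common refinement, which gives a map `|EA| × |EB| → |E(A × B)|`; its continuity makes the
composite paths `s ↦ γ(f(s); g₁(s), …, g_k(s))` continuous. The same map contracts `|EA|`, and the
length of the set on which two step functions agree shows that `|EG| → |EG|/H` is a covering. Hence
`π₁(|EG|/H) ≅ H`, where the projection of a path from `e` to `a e` corresponds to `a`; so does the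
projection of the edge `(e, a)` under `π₁(EG/H) ≅ H`. Along these isomorphisms the prescribed operad
structures are the structure of `𝓗`.
-/

section

open CategoryTheory Simplicial Opposite
open scoped unitInterval Topology

namespace GeometricRealization

variable {X : SSet.{u}}

lemma continuous_point {n : ℕ} (s : X _⦋n⦌) : Continuous (SSet.point s) :=
  ContinuousMap.continuous _

lemma point_map {n m : ℕ} (θ : ⦋n⦌ ⟶ ⦋m⦌) (s : X _⦋m⦌) (t : stdSimplex ℝ (Fin (n + 1))) :
    SSet.point (X.map θ.op s) t = SSet.point s (stdSimplex.map θ t) := by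
  have h : (sSetTopAdj.unit.app X).app (op ⦋n⦌) (X.map θ.op s) = _ :=
    congrArg (fun k => k s) ((sSetTopAdj.unit.app X).naturality θ.op)
  unfold SSet.point
  rw [h]
  rfl

lemma hom_ext {Y : TopCat.{u}} {f g : SSet.toTop.obj X ⟶ Y}
    (h : ∀ n (s : X _⦋n⦌) t, f (SSet.point s t) = g (SSet.point s t)) : f = g := by
  refine (sSetTopAdj.homEquiv X Y).injective ?_
  rw [Adjunction.homEquiv_unit, Adjunction.homEquiv_unit]
  ext n s
  refine (TopCat.toSSetObjEquiv Y n).injective ?_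
  ext t
  exact h n.unop.len s t

lemma exists_eq_point (p : SSet.toTop.obj X) :
    ∃ (n : ℕ) (s : X _⦋n⦌) (t : stdSimplex ℝ (Fin (n + 1))), p = SSet.point s t := by
  -- A map to an indiscrete space is determined by its values on the simplices.
  let _ : TopologicalSpace (ULift.{u} Prop) := ⊤
  let f (S : Set (SSet.toTop.obj X)) : SSet.toTop.obj X ⟶ TopCat.of (ULift.{u} Prop) :=
    TopCat.ofHom ⟨fun p => ULift.up (p ∈ S), continuous_top⟩
  have h : f {p | ∃ (n : ℕ) (s : X _⦋n⦌) (t : _), p = SSet.point s t} = f Set.univ :=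
    hom_ext fun n s t => congrArg ULift.up (eq_true ⟨n, s, t, rfl⟩)
  exact of_eq_true (congrArg (fun k => (k p).down) h)

/-- The universal property of the geometric realization: the continuous map given by a compatible
family of continuous maps on the simplices. -/
noncomputable def lift {Y : Type u} [TopologicalSpace Y]
    (F : ∀ {n : ℕ}, X _⦋n⦌ → C(stdSimplex ℝ (Fin (n + 1)), Y))
    (hF : ∀ {n m : ℕ} (θ : ⦋n⦌ ⟶ ⦋m⦌) (s : X _⦋m⦌) (t : stdSimplex ℝ (Fin (n + 1))),
      F (X.map θ.op s) t = F s (stdSimplex.map θ t)) : C(SSet.toTop.obj X, Y) :=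
  ((sSetTopAdj.homEquiv X (TopCat.of Y)).symm
    { app n := ↾fun s => (TopCat.toSSetObjEquiv (TopCat.of Y) n).symm (F s)
      naturality n m θ := by
        ext s
        refine (TopCat.toSSetObjEquiv (TopCat.of Y) m).injective ?_
        ext t
        exact hF θ.unop s t }).hom

lemma lift_point {Y : Type u} [TopologicalSpace Y]
    (F : ∀ {n : ℕ}, X _⦋n⦌ → C(stdSimplex ℝ (Fin (n + 1)), Y))
    (hF : ∀ {n m : ℕ} (θ : ⦋n⦌ ⟶ ⦋m⦌) (s : X _⦋m⦌) (t : stdSimplex ℝ (Fin (n + 1))),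
      F (X.map θ.op s) t = F s (stdSimplex.map θ t))
    {n : ℕ} (s : X _⦋n⦌) (t : stdSimplex ℝ (Fin (n + 1))) :
    lift F hF (SSet.point s t) = F s t :=
  congrArg (fun k => TopCat.toSSetObjEquiv (TopCat.of Y) (op ⦋n⦌) (k.app (op ⦋n⦌) s) t)
    ((Adjunction.homEquiv_unit ..).symm.trans
      ((sSetTopAdj.homEquiv X (TopCat.of Y)).apply_symm_apply _))

end GeometricRealization

section Simplex

variable {ι κ : Type*} [Fintype ι] [Fintype κ]

lemma nonempty_of_stdSimplex (t : stdSimplex ℝ ι) : Nonempty ι := by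
  by_contra! h
  simpa only [Finset.univ_eq_empty, Finset.sum_empty, zero_ne_one] using stdSimplex.sum_eq_one t

lemma sum_stdSimplex_mono (t : stdSimplex ℝ ι) {s s' : Finset ι} (h : s ⊆ s') :
    ∑ i ∈ s, t i ≤ ∑ i ∈ s', t i :=
  Finset.sum_le_sum_of_subset_of_nonneg h fun i _ _ => stdSimplex.zero_le t i

lemma sum_stdSimplex_map [DecidableEq κ] (f : ι → κ) (t : stdSimplex ℝ ι) (s : Finset κ) :
    ∑ k ∈ s, stdSimplex.map f t k = ∑ i with f i ∈ s, t i := by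
  simp only [stdSimplex.map_coe, FunOnFinite.linearMap_apply_apply]
  exact Finset.sum_fiberwise_eq_sum_filter Finset.univ s f t

lemma stdSimplex_map_apply [DecidableEq κ] (f : ι → κ) (t : stdSimplex ℝ ι) (k : κ) :
    stdSimplex.map f t k = ∑ i with f i = k, t i := by
  rw [stdSimplex.map_coe, FunOnFinite.linearMap_apply_apply]

lemma stdSimplex_map_apply_of_injective {f : ι → κ} (hf : Function.Injective f)
    (t : stdSimplex ℝ ι) (i : ι) : stdSimplex.map f t (f i) = t i := by
  classical
  rw [stdSimplex_map_apply, Finset.sum_eq_single i (fun j hj hji => ?_) (by simp)]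
  exact absurd (hf (Finset.mem_filter.1 hj).2) hji

lemma exists_stdSimplex_map_subtype_val_eq (t : stdSimplex ℝ ι) :
    ∃ t' : stdSimplex ℝ {i // t i ≠ 0}, stdSimplex.map Subtype.val t' = t := by
  classical
  have hsum : ∑ i : {i // t i ≠ 0}, t i = 1 := by
    rw [← Finset.sum_subtype (Finset.univ.filter (t · ≠ 0)) (by simp) t,
      Finset.sum_filter_ne_zero, stdSimplex.sum_eq_one]
  refine ⟨⟨fun i => t i, fun i => stdSimplex.zero_le t i, hsum⟩,
    stdSimplex.ext (funext fun i => ?_)⟩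
  by_cases hi : t i = 0
  · rw [hi, stdSimplex_map_apply]
    exact Finset.sum_eq_zero fun j hj => absurd ((Finset.mem_filter.1 hj).2 ▸ hi) j.2
  · exact stdSimplex_map_apply_of_injective Subtype.val_injective _ ⟨i, hi⟩

end Simplex

namespace IntervalPartition

open MeasureTheory

variable {ι κ κ' : Type*} [Fintype ι] [LinearOrder ι] [Fintype κ] [LinearOrder κ]
  [Fintype κ'] [LinearOrder κ']

/-- A point `t` of the simplex on a finite linear order partitions `(0, 1]` into consecutive
intervals of lengths `t i`; this is the `i`-th of them (empty if `t i = 0`). -/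
def interval (t : stdSimplex ℝ ι) (i : ι) : Set ℝ :=
  Set.Ioc (∑ j with j < i, t j) (∑ j with j ≤ i, t j)

lemma sum_le_eq_sum_lt_add (t : stdSimplex ℝ ι) (i : ι) :
    ∑ j with j ≤ i, t j = ∑ j with j < i, t j + t i := by
  have h : (Finset.univ.filter (· ≤ i)) = insert i (Finset.univ.filter (· < i)) := by
    ext j
    simp [le_iff_eq_or_lt]
  rw [h, Finset.sum_insert (by simp), add_comm]

lemma volume_real_interval (t : stdSimplex ℝ ι) (i : ι) : volume.real (interval t i) = t i := by
  rw [interval, sum_le_eq_sum_lt_add, Real.volume_real_Ioc, add_sub_cancel_left,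
    max_eq_left (stdSimplex.zero_le t i)]

lemma le_of_mem_interval {t : stdSimplex ℝ ι} {i i' : ι} {r r' : ℝ} (h : r ∈ interval t i)
    (h' : r' ∈ interval t i') (hr : r ≤ r') : i ≤ i' := by
  by_contra! hi
  refine lt_irrefl r' ?_
  calc r' ≤ ∑ j with j ≤ i', t j := h'.2
    _ ≤ ∑ j with j < i, t j :=
      sum_stdSimplex_mono t (Finset.monotone_filter_right _ fun _ _ hj => hj.trans_lt hi)
    _ < r := h.1
    _ ≤ r' := hr

lemma eq_of_mem_interval {t : stdSimplex ℝ ι} {i i' : ι} {r : ℝ} (h : r ∈ interval t i)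
    (h' : r ∈ interval t i') : i = i' :=
  le_antisymm (le_of_mem_interval h h' le_rfl) (le_of_mem_interval h' h le_rfl)

lemma interval_subset_Ioc (t : stdSimplex ℝ ι) (i : ι) : interval t i ⊆ Set.Ioc 0 1 :=
  Set.Ioc_subset_Ioc (Finset.sum_nonneg fun j _ => stdSimplex.zero_le t j)
    ((sum_stdSimplex_mono t (Finset.filter_subset _ _)).trans_eq (stdSimplex.sum_eq_one t))

lemma exists_mem_interval (t : stdSimplex ℝ ι) {r : ℝ} (hr : r ∈ Set.Ioc 0 1) :
    ∃ i, r ∈ interval t i := by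
  have := nonempty_of_stdSimplex t
  have hne : (Finset.univ.filter fun i => r ≤ ∑ j with j ≤ i, t j).Nonempty := by
    obtain ⟨i, hi⟩ := Finite.exists_max (fun i : ι => i)
    refine ⟨i, Finset.mem_filter.2 ⟨Finset.mem_univ i, ?_⟩⟩
    rw [Finset.filter_true_of_mem fun j _ => hi j, stdSimplex.sum_eq_one]
    exact hr.2
  obtain ⟨i, hi, hmin⟩ := Finset.exists_min_image _ id hne
  refine ⟨i, ?_, (Finset.mem_filter.1 hi).2⟩
  by_contra! hri
  have hlt : (Finset.univ.filter (· < i)).Nonempty := by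
    by_contra! hempty
    rw [hempty, Finset.sum_empty] at hri
    exact hri.not_gt hr.1
  obtain ⟨i', hi', hmax⟩ := Finset.exists_max_image _ id hlt
  have hri' : r ≤ ∑ j with j ≤ i', t j :=
    hri.trans (sum_stdSimplex_mono t fun j hj => by simpa using hmax j hj)
  have hle : i ≤ i' := hmin i' (by simpa using hri')
  exact hle.not_gt (by simpa using hi')

lemma iUnion_interval (t : stdSimplex ℝ ι) : ⋃ i, interval t i = Set.Ioc 0 1 :=
  (Set.iUnion_subset (interval_subset_Ioc t)).antisymm fun _ hr =>
    Set.mem_iUnion.2 (exists_mem_interval t hr)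

lemma interval_subset_interval_map {f : ι → κ} (hf : Monotone f) (t : stdSimplex ℝ ι) (i : ι) :
    interval t i ⊆ interval (stdSimplex.map f t) (f i) := by
  unfold interval
  simp only [sum_stdSimplex_map, Finset.mem_filter_univ]
  exact Set.Ioc_subset_Ioc
    (sum_stdSimplex_mono t (Finset.monotone_filter_right _ fun _ _ h => hf.reflect_lt h))
    (sum_stdSimplex_mono t (Finset.monotone_filter_right _ fun _ _ h => hf h))

lemma interval_map {f : ι → κ} (hf : Monotone f) (t : stdSimplex ℝ ι) (k : κ) :
    interval (stdSimplex.map f t) k = ⋃ i ∈ Finset.univ.filter (f · = k), interval t i := by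
  ext r
  simp only [Finset.mem_filter_univ, Set.mem_iUnion, exists_prop]
  constructor
  · intro hr
    obtain ⟨i, hi⟩ := exists_mem_interval t (interval_subset_Ioc _ _ hr)
    exact ⟨i, eq_of_mem_interval (interval_subset_interval_map hf t i hi) hr, hi⟩
  · rintro ⟨i, rfl, hi⟩
    exact interval_subset_interval_map hf t i hi

/-- The length of the intersection of the `i`-th interval of `t` and the `j`-th interval of `u`. -/
noncomputable def overlapLength (t : stdSimplex ℝ ι) (u : stdSimplex ℝ κ) (i : ι) (j : κ) : ℝ :=
  volume.real (interval t i ∩ interval u j)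

lemma overlapLength_comm (t : stdSimplex ℝ ι) (u : stdSimplex ℝ κ) (i : ι) (j : κ) :
    overlapLength t u i j = overlapLength u t j i := by
  rw [overlapLength, Set.inter_comm, overlapLength]

lemma sum_overlapLength (t : stdSimplex ℝ ι) (u : stdSimplex ℝ κ) (i : ι) (s : Finset κ) :
    ∑ j ∈ s, overlapLength t u i j = volume.real (interval t i ∩ ⋃ j ∈ s, interval u j) := by
  rw [Set.inter_iUnion₂]
  refine (measureReal_biUnion_finset (fun j _ j' _ hj => ?_)
    (fun j _ => measurableSet_Ioc.inter measurableSet_Ioc)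
    (fun j _ => measure_ne_top_of_subset Set.inter_subset_left measure_Ioc_lt_top.ne)).symm
  exact Set.disjoint_left.2 fun r hr hr' => hj (eq_of_mem_interval hr.2 hr'.2)

lemma sum_univ_overlapLength (t : stdSimplex ℝ ι) (u : stdSimplex ℝ κ) (i : ι) :
    ∑ j, overlapLength t u i j = t i := by
  rw [sum_overlapLength]
  simp only [Finset.mem_univ, Set.iUnion_true]
  rw [iUnion_interval, Set.inter_eq_left.2 (interval_subset_Ioc t i), volume_real_interval]

lemma overlapLength_map_right {f : κ → κ'} (hf : Monotone f) (t : stdSimplex ℝ ι)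
    (u : stdSimplex ℝ κ) (i : ι) (k : κ') :
    overlapLength t (stdSimplex.map f u) i k = ∑ j with f j = k, overlapLength t u i j := by
  rw [sum_overlapLength, overlapLength, interval_map hf]

lemma overlapLength_self_of_ne (t : stdSimplex ℝ ι) {i j : ι} (h : i ≠ j) :
    overlapLength t t i j = 0 := by
  have hdisjoint : interval t i ∩ interval t j = ∅ :=
    Set.eq_empty_of_forall_notMem fun r hr => h (eq_of_mem_interval hr.1 hr.2)
  rw [overlapLength, hdisjoint, measureReal_empty]

lemma le_of_overlapLength_ne_zero {t : stdSimplex ℝ ι} {u : stdSimplex ℝ κ} {i i' : ι} {j j' : κ}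
    (h : overlapLength t u i j ≠ 0) (h' : overlapLength t u i' j' ≠ 0) (hi : i < i') : j ≤ j' := by
  obtain ⟨r, hr⟩ := nonempty_of_measureReal_ne_zero h
  obtain ⟨r', hr'⟩ := nonempty_of_measureReal_ne_zero h'
  refine le_of_mem_interval hr.2 hr'.2 (le_of_not_ge fun hrr' => hi.not_ge ?_)
  exact le_of_mem_interval hr'.1 hr.1 hrr'

lemma continuous_overlapLength (i : ι) (j : κ) :
    Continuous fun p : stdSimplex ℝ ι × stdSimplex ℝ κ => overlapLength p.1 p.2 i j := by
  have hι (k : ι) : Continuous fun p : stdSimplex ℝ ι × stdSimplex ℝ κ => p.1 k :=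
    (continuous_apply k).comp (continuous_subtype_val.comp continuous_fst)
  have hκ (k : κ) : Continuous fun p : stdSimplex ℝ ι × stdSimplex ℝ κ => p.2 k :=
    (continuous_apply k).comp (continuous_subtype_val.comp continuous_snd)
  simp only [overlapLength, interval, Set.Ioc_inter_Ioc, Real.volume_real_Ioc]
  fun_prop

/-- The common refinement of the partitions given by `t` and `u`. Its nonempty intervals are indexed
increasingly by the lexicographic product, since both coordinates are monotone on the support. -/
noncomputable def overlap (t : stdSimplex ℝ ι) (u : stdSimplex ℝ κ) : stdSimplex ℝ (ι ×ₗ κ) :=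
  ⟨fun p => overlapLength t u (ofLex p).1 (ofLex p).2, fun _ => measureReal_nonneg, by
    rw [← Equiv.sum_comp toLex, Fintype.sum_prod_type]
    exact (Finset.sum_congr rfl fun i _ => sum_univ_overlapLength t u i).trans
      (stdSimplex.sum_eq_one t)⟩

lemma overlap_apply (t : stdSimplex ℝ ι) (u : stdSimplex ℝ κ) (i : ι) (j : κ) :
    overlap t u (toLex (i, j)) = overlapLength t u i j := rfl

lemma continuous_overlap :
    Continuous fun p : stdSimplex ℝ ι × stdSimplex ℝ κ => overlap p.1 p.2 :=
  Continuous.subtype_mk (continuous_pi fun _ => continuous_overlapLength _ _) _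

lemma le_and_le_of_overlap_ne_zero {t : stdSimplex ℝ ι} {u : stdSimplex ℝ κ} {p q : ι ×ₗ κ}
    (hp : overlap t u p ≠ 0) (hq : overlap t u q ≠ 0) (h : p ≤ q) :
    (ofLex p).1 ≤ (ofLex q).1 ∧ (ofLex p).2 ≤ (ofLex q).2 := by
  rcases Prod.Lex.le_iff.1 h with h | ⟨h, h'⟩
  · exact ⟨h.le, le_of_overlapLength_ne_zero hp hq h⟩
  · exact ⟨h.le, h'⟩

lemma map_fst_overlap (t : stdSimplex ℝ ι) (u : stdSimplex ℝ κ) :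
    stdSimplex.map (fun p : ι ×ₗ κ => (ofLex p).1) (overlap t u) = t := by
  refine stdSimplex.ext (funext fun i => ?_)
  rw [stdSimplex_map_apply, Finset.sum_filter, ← Equiv.sum_comp toLex, Fintype.sum_prod_type,
    Finset.sum_eq_single i (fun j _ hj => by simp [hj]) (by simp)]
  simpa [overlap_apply] using sum_univ_overlapLength t u i

lemma map_swap_overlap (t : stdSimplex ℝ ι) (u : stdSimplex ℝ κ) :
    stdSimplex.map (fun p : ι ×ₗ κ => toLex (ofLex p).swap) (overlap t u) = overlap u t := by
  refine stdSimplex.ext (funext fun p => ?_)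
  obtain ⟨⟨j, i⟩, rfl⟩ := toLex.surjective p
  have hswap : Function.Injective fun p : ι ×ₗ κ => toLex (ofLex p).swap :=
    toLex.injective.comp (Prod.swap_injective.comp ofLex.injective)
  exact (stdSimplex_map_apply_of_injective hswap (overlap t u) (toLex (i, j))).trans
    (overlapLength_comm t u i j)

lemma map_snd_overlap (t : stdSimplex ℝ ι) (u : stdSimplex ℝ κ) :
    stdSimplex.map (fun p : ι ×ₗ κ => (ofLex p).2) (overlap t u) = u := by
  rw [← map_swap_overlap u t, stdSimplex.map_comp_apply]
  exact map_fst_overlap u t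

lemma overlap_map_right {f : κ → κ'} (hf : Monotone f) (t : stdSimplex ℝ ι)
    (u : stdSimplex ℝ κ) :
    overlap t (stdSimplex.map f u) =
      stdSimplex.map (fun p : ι ×ₗ κ => toLex ((ofLex p).1, f (ofLex p).2)) (overlap t u) := by
  refine stdSimplex.ext (funext fun p => ?_)
  obtain ⟨⟨i, k⟩, rfl⟩ := toLex.surjective p
  rw [stdSimplex_map_apply, Finset.sum_filter, ← Equiv.sum_comp toLex, Fintype.sum_prod_type,
    Finset.sum_eq_single i (fun j _ hj => by simp [hj]) (by simp), overlap_apply,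
    overlapLength_map_right hf, Finset.sum_filter]
  simp only [ofLex_toLex, overlap_apply, EmbeddingLike.apply_eq_iff_eq, Prod.mk.injEq, true_and]

lemma overlap_map_left {f : κ → κ'} (hf : Monotone f) (u : stdSimplex ℝ κ)
    (t : stdSimplex ℝ ι) :
    overlap (stdSimplex.map f u) t =
      stdSimplex.map (fun p : κ ×ₗ ι => toLex (f (ofLex p).1, (ofLex p).2)) (overlap u t) := by
  rw [← map_swap_overlap, overlap_map_right hf, ← map_swap_overlap t u,
    stdSimplex.map_comp_apply, stdSimplex.map_comp_apply]
  rfl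

lemma overlap_self (t : stdSimplex ℝ ι) :
    overlap t t = stdSimplex.map (fun i => toLex (i, i)) t := by
  refine stdSimplex.ext (funext fun p => ?_)
  obtain ⟨⟨i, j⟩, rfl⟩ := toLex.surjective p
  rcases eq_or_ne i j with rfl | hij
  · have hdiag : Function.Injective fun i : ι => toLex (i, i) := fun i j h =>
      congrArg (fun p => (ofLex p).1) h
    rw [stdSimplex_map_apply_of_injective hdiag, overlap_apply, overlapLength, Set.inter_self,
      volume_real_interval]
  · rw [overlap_apply, overlapLength_self_of_ne t hij, stdSimplex_map_apply, Finset.sum_filter]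
    refine (Finset.sum_eq_zero fun k _ => if_neg fun h => hij ?_).symm
    obtain ⟨rfl, rfl⟩ := Prod.mk.inj (toLex.injective h)
    rfl

end IntervalPartition

namespace RealE

variable {A B C : Type u}

section Points

variable {ι κ : Type} [Fintype ι] [LinearOrder ι] [Nonempty ι] [Fintype κ] [LinearOrder κ]
  [Nonempty κ]

lemma point_comp {n m : ℕ} (f : Fin (n + 1) →o Fin (m + 1)) (x : Fin (m + 1) → A)
    (t : stdSimplex ℝ (Fin (n + 1))) :
    SSet.point (X := EG A) (n := n) (x ∘ f) t =
      SSet.point (X := EG A) (n := m) x (stdSimplex.map f t) :=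
  GeometricRealization.point_map (X := EG A) (SimplexCategory.mkHom f) x t

variable (ι) in
/-- The order isomorphism from `{0, …, n}` to a finite nonempty linear order. -/
noncomputable def indexIso : Fin (Fintype.card ι - 1 + 1) ≃o ι :=
  (Fin.castOrderIso (Nat.sub_add_cancel Fintype.card_pos)).trans (Fintype.orderIsoFinOfCardEq ι rfl)

/-- The point of `|EA|` in the simplex with vertices `x i`, where `i` runs over a finite linear
order, that has the barycentric coordinates `t i`. As a step function on `(0, 1]`, it takes the
value `x i` on the `i`-th interval of `t`. -/
noncomputable def pt (x : ι → A) (t : stdSimplex ℝ ι) : RealE A :=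
  SSet.point (X := EG A) (n := Fintype.card ι - 1) (x ∘ indexIso ι)
    (stdSimplex.map (indexIso ι).symm t)

lemma continuous_pt (x : ι → A) : Continuous (pt x) :=
  (GeometricRealization.continuous_point _).comp (stdSimplex.continuous_map _)

lemma pt_comp_of_monotone {f : ι → κ} (hf : Monotone f) (x : κ → A) (t : stdSimplex ℝ ι) :
    pt (x ∘ f) t = pt x (stdSimplex.map f t) := by
  have hx : (x ∘ f) ∘ indexIso ι = (x ∘ indexIso κ) ∘ ((indexIso κ).symm ∘ f ∘ indexIso ι) :=
    funext fun i => congrArg x ((indexIso κ).apply_symm_apply _).symm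
  have ht : stdSimplex.map ((indexIso κ).symm ∘ f ∘ indexIso ι)
      (stdSimplex.map (indexIso ι).symm t) =
        stdSimplex.map (indexIso κ).symm (stdSimplex.map f t) := by
    rw [stdSimplex.map_comp_apply, stdSimplex.map_comp_apply]
    exact congrArg (stdSimplex.map · t)
      (funext fun i => congrArg ((indexIso κ).symm ∘ f) ((indexIso ι).apply_symm_apply i))
  unfold pt
  rw [hx, ← ht]
  exact point_comp ⟨_, (indexIso κ).symm.monotone.comp (hf.comp (indexIso ι).monotone)⟩ _ _

lemma pt_comp {f : ι → κ} {t : stdSimplex ℝ ι} (hf : MonotoneOn f {i | t i ≠ 0}) (x : κ → A) :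
    pt (x ∘ f) t = pt x (stdSimplex.map f t) := by
  obtain ⟨t', ht'⟩ := exists_stdSimplex_map_subtype_val_eq t
  have := nonempty_of_stdSimplex t'
  have hmono : Monotone (f ∘ Subtype.val : {i // t i ≠ 0} → κ) := fun i j => hf i.2 j.2
  calc pt (x ∘ f) t = pt (x ∘ f) (stdSimplex.map Subtype.val t') := by rw [ht']
    _ = pt (x ∘ f ∘ Subtype.val) t' := (pt_comp_of_monotone (Subtype.mono_coe _) _ _).symm
    _ = pt x (stdSimplex.map (f ∘ Subtype.val) t') := pt_comp_of_monotone hmono x t'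
    _ = pt x (stdSimplex.map f t) := by rw [← stdSimplex.map_comp_apply, ht']

lemma pt_fin {n : ℕ} (x : Fin (n + 1) → A) (t : stdSimplex ℝ (Fin (n + 1))) :
    pt x t = SSet.point (X := EG A) (n := n) x t := by
  refine (point_comp (indexIso (Fin (n + 1))).toOrderEmbedding.toOrderHom x _).trans ?_
  refine congrArg (SSet.point (X := EG A) (n := n) x) ?_
  refine (stdSimplex.map_comp_apply _ _ _).trans ?_
  refine Eq.trans (congrArg (stdSimplex.map · t) (funext fun i => ?_)) (stdSimplex.map_id_apply t)
  exact (indexIso (Fin (n + 1))).apply_symm_apply i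

end Points

lemma exists_eq_pt (p : RealE A) :
    ∃ (n : ℕ) (x : Fin (n + 1) → A) (t : stdSimplex ℝ (Fin (n + 1))), p = pt x t := by
  obtain ⟨n, x, t, rfl⟩ := GeometricRealization.exists_eq_point (X := EG A) p
  exact ⟨n, x, t, (pt_fin x t).symm⟩

/-- The continuous map on `|EA|` given by a compatible family of continuous maps on the
simplices. -/
noncomputable def lift {Y : Type u} [TopologicalSpace Y]
    (F : ∀ {n : ℕ}, (Fin (n + 1) → A) → C(stdSimplex ℝ (Fin (n + 1)), Y))
    (hF : ∀ ⦃n m : ℕ⦄ (θ : Fin (n + 1) →o Fin (m + 1)) (x : Fin (m + 1) → A)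
      (t : stdSimplex ℝ (Fin (n + 1))), F (x ∘ θ) t = F x (stdSimplex.map θ t)) : C(RealE A, Y) :=
  GeometricRealization.lift (X := EG A) F fun θ => hF θ.toOrderHom

lemma lift_pt {Y : Type u} [TopologicalSpace Y]
    {F : ∀ {n : ℕ}, (Fin (n + 1) → A) → C(stdSimplex ℝ (Fin (n + 1)), Y)}
    {hF : ∀ ⦃n m : ℕ⦄ (θ : Fin (n + 1) →o Fin (m + 1)) (x : Fin (m + 1) → A)
      (t : stdSimplex ℝ (Fin (n + 1))), F (x ∘ θ) t = F x (stdSimplex.map θ t)}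
    {n : ℕ} (x : Fin (n + 1) → A) (t : stdSimplex ℝ (Fin (n + 1))) :
    lift F hF (pt x t) = F x t := by
  rw [pt_fin]
  exact GeometricRealization.lift_point (X := EG A) F (fun θ => hF θ.toOrderHom) x t

/-- The map `|EA| → |EB|` induced by a map of sets `A → B`. -/
noncomputable def map (φ : A → B) : C(RealE A, RealE B) :=
  (SSet.toTop.map (show EG A ⟶ EG B from
    { app n := ↾fun (x : Fin (n.unop.len + 1) → A) => φ ∘ x
      naturality _ _ _ := rfl })).hom

section Functoriality

variable {ι : Type} [Fintype ι] [LinearOrder ι] [Nonempty ι]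

lemma map_pt (φ : A → B) (x : ι → A) (t : stdSimplex ℝ ι) : map φ (pt x t) = pt (φ ∘ x) t :=
  SSet.map_point _ _ _

lemma map_map (ψ : B → C) (φ : A → B) (p : RealE A) : map ψ (map φ p) = map (ψ ∘ φ) p := by
  obtain ⟨n, x, t, rfl⟩ := exists_eq_pt p
  rw [map_pt, map_pt, map_pt, Function.comp_assoc]

lemma map_id (p : RealE A) : map id p = p := by
  obtain ⟨n, x, t, rfl⟩ := exists_eq_pt p
  rw [map_pt, Function.id_comp]

lemma smul_eq_map [Group A] (g : A) (p : RealE A) : g • p = map (g * ·) p := by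
  obtain ⟨n, x, t, rfl⟩ := exists_eq_pt p
  exact (SSet.map_point _ _ _).trans (SSet.map_point _ _ _).symm

/-- The vertex `a` of `|EA|`. -/
noncomputable def vertex (a : A) : RealE A :=
  pt (fun _ : Unit => a) (stdSimplex.vertex ())

lemma pt_const (a : A) (t : stdSimplex ℝ ι) :
    pt (fun _ => a) t = vertex a := by
  refine (pt_comp_of_monotone (f := fun _ => ()) monotone_const (fun _ => a) t).trans ?_
  exact congrArg (pt _) (Subsingleton.elim (α := stdSimplex ℝ Unit) _ _)

lemma map_const (b : B) (p : RealE A) : map (fun _ => b) p = vertex b := by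
  obtain ⟨n, x, t, rfl⟩ := exists_eq_pt p
  exact (map_pt _ x t).trans (pt_const b t)

lemma map_vertex (φ : A → B) (a : A) : map φ (vertex a) = vertex (φ a) :=
  map_pt φ _ _

lemma base_eq_vertex [Group A] : RealE.base A = vertex (1 : A) :=
  (pt_fin _ _).symm.trans (pt_const (1 : A) _)

lemma smul_base [Group A] (g : A) : g • RealE.base A = vertex g := by
  rw [base_eq_vertex, smul_eq_map, map_vertex, mul_one]

end Functoriality

end RealE

namespace RealE

open IntervalPartition

variable {A B C : Type u}

section Pair

section Points

variable {ι κ κ' : Type} [Fintype ι] [LinearOrder ι] [Fintype κ] [LinearOrder κ]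
  [Fintype κ'] [LinearOrder κ'] [Nonempty ι] [Nonempty κ] [Nonempty κ']

/-- The step function `r ↦ (f r, g r)`, where `f` and `g` are the step functions with the values
`x`, `y` on the intervals of `t`, `u`. -/
noncomputable def pairPt (x : ι → A) (t : stdSimplex ℝ ι) (y : κ → B) (u : stdSimplex ℝ κ) :
    RealE (A × B) :=
  pt (fun r : ι ×ₗ κ => (x (ofLex r).1, y (ofLex r).2)) (overlap t u)

lemma continuous_pairPt (x : ι → A) (y : κ → B) :
    Continuous fun p : stdSimplex ℝ ι × stdSimplex ℝ κ => pairPt x p.1 y p.2 :=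
  (continuous_pt _).comp continuous_overlap

lemma pairPt_comp_left {f : ι → κ} (hf : Monotone f) (x : κ → A) (t : stdSimplex ℝ ι)
    (y : κ' → B) (u : stdSimplex ℝ κ') :
    pairPt (x ∘ f) t y u = pairPt x (stdSimplex.map f t) y u := by
  have hmono : MonotoneOn (fun p : ι ×ₗ κ' => toLex (f (ofLex p).1, (ofLex p).2))
      {p | overlap t u p ≠ 0} := fun p hp q hq hpq =>
    have h := le_and_le_of_overlap_ne_zero hp hq hpq
    Prod.Lex.toLex_mono ⟨hf h.1, h.2⟩
  rw [pairPt, pairPt, overlap_map_left hf]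
  exact pt_comp hmono fun r => (x (ofLex r).1, y (ofLex r).2)

lemma pairPt_comp_right {f : ι → κ} (hf : Monotone f) (x : κ' → A) (t : stdSimplex ℝ κ')
    (y : κ → B) (u : stdSimplex ℝ ι) :
    pairPt x t (y ∘ f) u = pairPt x t y (stdSimplex.map f u) := by
  have hmono : MonotoneOn (fun p : κ' ×ₗ ι => toLex ((ofLex p).1, f (ofLex p).2))
      {p | overlap t u p ≠ 0} := fun p hp q hq hpq =>
    have h := le_and_le_of_overlap_ne_zero hp hq hpq
    Prod.Lex.toLex_mono ⟨h.1, hf h.2⟩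
  rw [pairPt, pairPt, overlap_map_right hf]
  exact pt_comp hmono fun r => (x (ofLex r).1, y (ofLex r).2)

lemma map_fst_pairPt (x : ι → A) (t : stdSimplex ℝ ι) (y : κ → B) (u : stdSimplex ℝ κ) :
    map (Prod.fst : A × B → A) (pairPt x t y u) = pt x t := by
  have hfst : Monotone fun r : ι ×ₗ κ => (ofLex r).1 := Prod.Lex.monotone_fst
  rw [pairPt, map_pt]
  exact (pt_comp_of_monotone hfst x _).trans (congrArg (pt x) (map_fst_overlap t u))

lemma map_snd_pairPt (x : ι → A) (t : stdSimplex ℝ ι) (y : κ → B) (u : stdSimplex ℝ κ) :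
    map (Prod.snd : A × B → B) (pairPt x t y u) = pt y u := by
  have hsnd : MonotoneOn (fun r : ι ×ₗ κ => (ofLex r).2) {r | overlap t u r ≠ 0} :=
    fun p hp q hq hpq => (le_and_le_of_overlap_ne_zero hp hq hpq).2
  rw [pairPt, map_pt]
  exact (pt_comp hsnd y).trans (congrArg (pt y) (map_snd_overlap t u))

lemma pairPt_self (x : ι → A) (y : ι → B) (t : stdSimplex ℝ ι) :
    pairPt x t y t = pt (fun i => (x i, y i)) t := by
  have hdiag : Monotone fun i : ι => toLex (i, i) := fun i j h => Prod.Lex.toLex_mono ⟨h, h⟩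
  rw [pairPt, overlap_self]
  exact (pt_comp_of_monotone hdiag _ t).symm

end Points

/-- The map `|EA| × Δ^n → |E(A × B)|` that pairs with the `n`-simplex `y` of `EB`, in curried
form. -/
noncomputable def pairSimplex {n : ℕ} (y : Fin (n + 1) → B) :
    C(RealE A, C(stdSimplex ℝ (Fin (n + 1)), RealE (A × B))) :=
  lift (fun x => ContinuousMap.curry ⟨fun p => pairPt x p.1 y p.2, continuous_pairPt x y⟩)
    fun _ _ θ x t => ContinuousMap.ext fun u => pairPt_comp_left θ.monotone x t y u

lemma pairSimplex_pt {n m : ℕ} (x : Fin (m + 1) → A) (t : stdSimplex ℝ (Fin (m + 1)))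
    (y : Fin (n + 1) → B) (u : stdSimplex ℝ (Fin (n + 1))) :
    pairSimplex y (pt x t) u = pairPt x t y u :=
  congrArg (fun f : C(_, _) => f u) (lift_pt x t)

/-- The pairing `|EA| × |EB| → |E(A × B)|`, inverse to the map given by the two projections. It is
continuous in each variable; see `continuous_pair` for the joint continuity. -/
noncomputable def pair (p : RealE A) : C(RealE B, RealE (A × B)) :=
  lift (fun y => pairSimplex y p) fun _ _ θ y u => by
    obtain ⟨m, x, t, rfl⟩ := exists_eq_pt p
    rw [pairSimplex_pt, pairSimplex_pt, pairPt_comp_right θ.monotone]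

lemma pair_pt (p : RealE A) {n : ℕ} (y : Fin (n + 1) → B) (u : stdSimplex ℝ (Fin (n + 1))) :
    pair p (pt y u) = pairSimplex y p u :=
  lift_pt y u

lemma pair_pt_pt {n m : ℕ} (x : Fin (m + 1) → A) (t : stdSimplex ℝ (Fin (m + 1)))
    (y : Fin (n + 1) → B) (u : stdSimplex ℝ (Fin (n + 1))) :
    pair (pt x t) (pt y u) = pairPt x t y u := by
  rw [pair_pt, pairSimplex_pt]

lemma map_fst_pair (p : RealE A) (q : RealE B) : map (Prod.fst : A × B → A) (pair p q) = p := by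
  obtain ⟨m, x, t, rfl⟩ := exists_eq_pt p
  obtain ⟨n, y, u, rfl⟩ := exists_eq_pt q
  rw [pair_pt_pt, map_fst_pairPt]

lemma map_snd_pair (p : RealE A) (q : RealE B) : map (Prod.snd : A × B → B) (pair p q) = q := by
  obtain ⟨m, x, t, rfl⟩ := exists_eq_pt p
  obtain ⟨n, y, u, rfl⟩ := exists_eq_pt q
  rw [pair_pt_pt, map_snd_pairPt]

lemma pair_map_map (φ : C → A) (ψ : C → B) (r : RealE C) :
    pair (map φ r) (map ψ r) = map (fun c => (φ c, ψ c)) r := by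
  obtain ⟨n, z, t, rfl⟩ := exists_eq_pt r
  rw [map_pt, map_pt, map_pt, pair_pt_pt, pairPt_self]
  rfl

lemma pair_map_right (p : RealE A) (φ : B → C) (q : RealE B) :
    pair p (map φ q) = map (fun x => (x.1, φ x.2)) (pair p q) :=
  calc pair p (map φ q)
    _ = pair (map (Prod.fst : A × B → A) (pair p q)) (map (φ ∘ Prod.snd) (pair p q)) := by
      rw [map_fst_pair, ← map_map, map_snd_pair]
    _ = map (fun x => (x.1, φ x.2)) (pair p q) := pair_map_map _ _ _

lemma pair_vertex_right (p : RealE A) (b : B) : pair p (vertex b) = map (fun a => (a, b)) p :=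
  calc pair p (vertex b) = pair (map id p) (map (fun _ => b) p) := by rw [map_id, map_const]
    _ = map (fun a => (a, b)) p := pair_map_map _ _ _

lemma pair_vertex_vertex (a : A) (b : B) : pair (vertex a) (vertex b) = vertex (a, b) := by
  rw [pair_vertex_right, map_vertex]

lemma pairSimplex_vertex {n : ℕ} (y : Fin (n + 1) → B) (p : RealE A) (j : Fin (n + 1)) :
    pairSimplex y p (stdSimplex.vertex j) = map (fun a => (a, y j)) p := by
  have hy : pt y (stdSimplex.vertex j) = vertex (y j) := by
    rw [← stdSimplex.map_vertex (fun _ : Unit => j) ()]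
    exact (pt_comp_of_monotone monotone_const y _).symm
  rw [← pair_pt, hy, pair_vertex_right]

/-- Joint continuity holds along maps from a locally compact space `Z`, because then the maps
`Z → |E(A × B)|` given by the points of `|EB|` depend continuously on these points. -/
lemma continuous_pair {Z : Type} [TopologicalSpace Z] [LocallyCompactSpace Z]
    {f : Z → RealE A} {g : Z → RealE B} (hf : Continuous f) (hg : Continuous g) :
    Continuous fun z => pair (f z) (g z) := by
  let F : C(RealE B, C(Z, RealE (A × B))) :=
    lift (fun y => ContinuousMap.curry ⟨fun p => pairSimplex y (f p.2) p.1, by fun_prop⟩)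
      fun _ _ θ y u => ContinuousMap.ext fun z => by
        change pairSimplex (y ∘ θ) (f z) u = pairSimplex y (f z) (stdSimplex.map θ u)
        rw [← pair_pt, ← pair_pt, pt_comp_of_monotone θ.monotone]
  have hF (z : Z) (q : RealE B) : F q z = pair (f z) q := by
    obtain ⟨n, y, u, rfl⟩ := exists_eq_pt q
    exact (congrArg (fun φ : C(_, _) => φ z) (lift_pt y u)).trans (pair_pt _ y u).symm
  simp only [← hF]
  fun_prop

end Pair

section PiPair

/-- The point of `|E(∏ᵢ Bᵢ)|` with the given projections to the `|EBᵢ|`. -/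
noncomputable def piPair {k : ℕ} {B : Fin k → Type u} (q : ∀ i, RealE (B i)) :
    RealE (∀ i, B i) :=
  match k, B, q with
  | 0, _, _ => vertex finZeroElim
  | _ + 1, _, q => map (fun x => Fin.cons x.1 x.2) (pair (q 0) (piPair fun i => q i.succ))

lemma map_eval_piPair {k : ℕ} {B : Fin k → Type u} (q : ∀ i, RealE (B i)) (i : Fin k) :
    map (fun b : ∀ i, B i => b i) (piPair q) = q i := by
  induction k with
  | zero => exact i.elim0
  | succ k ih =>
    rw [piPair, map_map]
    refine Fin.cases ?_ (fun j => ?_) i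
    · exact map_fst_pair _ _
    · refine (map_map (fun b : ∀ i : Fin k, B i.succ => b j) Prod.snd _).symm.trans ?_
      rw [map_snd_pair, ih]

lemma piPair_vertex {k : ℕ} {B : Fin k → Type u} (b : ∀ i, B i) :
    piPair (fun i => vertex (b i)) = vertex b := by
  induction k with
  | zero => exact congrArg vertex (Subsingleton.elim _ _)
  | succ k ih =>
    rw [piPair, ih, pair_vertex_vertex, map_vertex]
    exact congrArg vertex (Fin.cons_self_tail b)

lemma continuous_piPair {Z : Type} [TopologicalSpace Z] [LocallyCompactSpace Z] {k : ℕ}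
    {B : Fin k → Type u} {q : Z → ∀ i, RealE (B i)} (hq : ∀ i, Continuous fun z => q z i) :
    Continuous fun z => piPair (q z) := by
  induction k with
  | zero => exact continuous_const
  | succ k ih => exact (map _).continuous.comp (continuous_pair (hq 0) (ih fun i => hq i.succ))

end PiPair

end RealE

namespace GroupOperad

variable {G : ℕ → Type u} [∀ n, Group (G n)] (𝒢 : GroupOperad G)

/-- The composition `|EG_k| × |EG_{m₁}| × ⋯ × |EG_{m_k}| → |EG_N|` of the topological operad `|E𝒢|`,
whose graph is `GroupOperad.IsRealγ`. -/
noncomputable def realγ {k : ℕ} (m : Fin k → ℕ) {N : ℕ} (h : ∑ i, m i = N) (p : RealE (G k))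
    (q : ∀ i, RealE (G (m i))) : RealE (G N) :=
  RealE.map (fun x => 𝒢.γ m h x.1 x.2) (RealE.pair p (RealE.piPair q))

variable {k : ℕ} (m : Fin k → ℕ) {N : ℕ} (h : ∑ i, m i = N)

lemma isRealγ_realγ (p : RealE (G k)) (q : ∀ i, RealE (G (m i))) :
    𝒢.IsRealγ m h p q (𝒢.realγ m h p q) := by
  obtain ⟨l, x, t, hx⟩ := RealE.exists_eq_pt (RealE.pair p (RealE.piPair q))
  refine ⟨l, t, fun j => (x j).1, fun i j => (x j).2 i, ?_, fun i => ?_, ?_⟩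
  · rw [← RealE.map_fst_pair p (RealE.piPair q), hx, RealE.map_pt]
    exact RealE.pt_fin _ t
  · rw [← RealE.map_eval_piPair q i, ← RealE.map_snd_pair p (RealE.piPair q), hx, RealE.map_pt,
      RealE.map_pt]
    exact RealE.pt_fin _ t
  · rw [realγ, hx, RealE.map_pt]
    exact RealE.pt_fin _ t

lemma realγ_vertex (a : G k) (b : ∀ i, G (m i)) :
    𝒢.realγ m h (RealE.vertex a) (fun i => RealE.vertex (b i)) = RealE.vertex (𝒢.γ m h a b) := by
  rw [realγ, RealE.piPair_vertex, RealE.pair_vertex_vertex, RealE.map_vertex]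

lemma continuous_realγ {Z : Type} [TopologicalSpace Z] [LocallyCompactSpace Z]
    {p : Z → RealE (G k)} {q : Z → ∀ i, RealE (G (m i))} (hp : Continuous p)
    (hq : ∀ i, Continuous fun z => q z i) : Continuous fun z => 𝒢.realγ m h (p z) (q z) :=
  (RealE.map _).continuous.comp (RealE.continuous_pair hp (RealE.continuous_piPair hq))

end GroupOperad

namespace RealE

section Contractible

variable {A B : Type u}

/-- The homotopy is the pairing with the `1`-simplex `(φ, ψ)` of `E(A → B)`, followed by
evaluation. -/
lemma homotopic_map (φ ψ : A → B) : (map φ).Homotopic (map ψ) := by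
  let eval (x : A × (A → B)) : B := x.2 x.1
  let e := stdSimplexHomeomorphUnitInterval.symm
  refine ⟨⟨⟨fun x => map eval (pairSimplex ![φ, ψ] x.2 (e x.1)), by fun_prop⟩, fun p => ?_,
    fun p => ?_⟩⟩
  · change map eval (pairSimplex ![φ, ψ] p (e 0)) = map φ p
    rw [← stdSimplexHomeomorphUnitInterval_zero, Homeomorph.symm_apply_apply, pairSimplex_vertex,
      map_map]
    rfl
  · change map eval (pairSimplex ![φ, ψ] p (e 1)) = map ψ p
    rw [← stdSimplexHomeomorphUnitInterval_one, Homeomorph.symm_apply_apply, pairSimplex_vertex,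
      map_map]
    rfl

instance [Nonempty A] : ContractibleSpace (RealE A) := by
  obtain ⟨a⟩ := ‹Nonempty A›
  have hid : map (id : A → A) = ContinuousMap.id _ := ContinuousMap.ext map_id
  have hconst : map (fun _ : A => a) = ContinuousMap.const _ (vertex a) :=
    ContinuousMap.ext (map_const a)
  exact (contractible_iff_id_nullhomotopic _).2
    ⟨vertex a, hid ▸ hconst ▸ homotopic_map id fun _ => a⟩

end Contractible

section Covering

variable {A B : Type u}

open scoped Classical in
/-- The length of the set on which a step function takes the value `a`. -/
noncomputable def valueLength (a : A) : C(RealE A, ℝ) :=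
  (⟨ULift.down, continuous_uliftDown⟩ : C(ULift.{u} ℝ, ℝ)).comp <|
    lift (fun x => ⟨fun t => ULift.up (∑ i with x i = a, t i), by fun_prop⟩) fun _ _ θ x t => by
      refine congrArg ULift.up (Eq.symm ?_)
      simpa only [Finset.mem_filter, Finset.mem_univ, true_and, Function.comp_apply,
        Set.mem_ofPred_eq] using sum_stdSimplex_map θ t {j | x j = a}

open scoped Classical in
lemma valueLength_pt (a : A) {n : ℕ} (x : Fin (n + 1) → A) (t : stdSimplex ℝ (Fin (n + 1))) :
    valueLength a (pt x t) = ∑ i with x i = a, t i := by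
  rw [valueLength, ContinuousMap.comp_apply, lift_pt]
  rfl

lemma exists_valueLength_pos (p : RealE A) : ∃ a, 0 < valueLength a p := by
  classical
  obtain ⟨n, x, t, rfl⟩ := exists_eq_pt p
  obtain ⟨i, -, hi⟩ : ∃ i ∈ Finset.univ, 0 < t i :=
    Finset.exists_lt_of_sum_lt (by simp [stdSimplex.sum_eq_one])
  refine ⟨x i, hi.trans_le ?_⟩
  rw [valueLength_pt]
  exact Finset.single_le_sum (f := t) (fun j _ => stdSimplex.zero_le t j) (by simp)

lemma valueLength_map {φ : A → B} (hφ : Function.Injective φ) (a : A) (p : RealE A) :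
    valueLength (φ a) (map φ p) = valueLength a p := by
  classical
  obtain ⟨n, x, t, rfl⟩ := exists_eq_pt p
  simp only [map_pt, valueLength_pt, Function.comp_apply, hφ.eq_iff]

lemma valueLength_add_valueLength_le (φ : A → B) {a₁ a₂ : A} (ha : a₁ ≠ a₂)
    (h : φ a₁ = φ a₂) (p : RealE A) :
    valueLength a₁ p + valueLength a₂ p ≤ valueLength (φ a₁) (map φ p) := by
  classical
  obtain ⟨n, x, t, rfl⟩ := exists_eq_pt p
  rw [map_pt, valueLength_pt, valueLength_pt, valueLength_pt, ← Finset.sum_union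
    (Finset.disjoint_filter.2 fun i _ h₁ h₂ => ha (h₁.symm.trans h₂))]
  refine sum_stdSimplex_mono t (Finset.union_subset ?_ ?_)
  · exact Finset.monotone_filter_right _ fun i _ hi => congrArg φ hi
  · exact Finset.monotone_filter_right _ fun i _ hi => (congrArg φ hi).trans h.symm

/-- For a value `a` of `p`, take the step functions that agree with `p` on more than half of the set
where `p` takes the value `a`. -/
lemma exists_nhds_disjoint_smul [Group A] (p : RealE A) :
    ∃ U ∈ 𝓝 p, ∀ g : A, ((g • ·) '' U ∩ U).Nonempty → g = 1 := by
  obtain ⟨a, ha⟩ := exists_valueLength_pos p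
  let agreement : C(RealE A, ℝ) := (valueLength (a, a)).comp (pair p)
  have agreement_self : agreement p = valueLength a p := by
    have hdiag : Function.Injective fun a : A => (a, a) := fun _ _ h => congrArg Prod.fst h
    have hpp : pair p p = map (fun a : A => (a, a)) p := by
      simpa only [map_id] using! pair_map_map (id : A → A) (id : A → A) p
    exact (congrArg _ hpp).trans (valueLength_map hdiag a p)
  have agreement_smul (g : A) (q : RealE A) :
      agreement (g • q) = valueLength (a, g⁻¹ * a) (pair p q) := by
    have hg : Function.Injective fun x : A × A => (x.1, g * x.2) :=
      Function.injective_id.prodMap (mul_right_injective g)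
    have h := valueLength_map hg (a, g⁻¹ * a) (pair p q)
    rwa [mul_inv_cancel_left, ← pair_map_right, ← smul_eq_map] at h
  refine ⟨{q | valueLength a p / 2 < agreement q},
    (isOpen_lt continuous_const agreement.continuous).mem_nhds ?_, ?_⟩
  · exact (half_lt_self ha).trans_eq agreement_self.symm
  · rintro g ⟨_, ⟨q, hq, rfl⟩, hgq⟩
    by_contra hg
    have hne : (a, a) ≠ (a, g⁻¹ * a) := fun h => hg (by simpa using congrArg Prod.snd h)
    have hle := valueLength_add_valueLength_le Prod.fst hne rfl (pair p q)
    rw [map_fst_pair, ← agreement_smul] at hle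
    change valueLength a p / 2 < valueLength (a, a) (pair p q) at hq
    change valueLength a p / 2 < agreement (g • q) at hgq
    linarith

lemma isQuotientCoveringMap [Group A] (H : Subgroup A) :
    IsQuotientCoveringMap (RealEmod.proj H) H where
  toIsQuotientMap := isQuotientMap_quotient_mk'
  continuous_const_smul h := (SSet.toTop.map (EG.smul (h : A))).hom.continuous
  apply_eq_iff_mem_orbit := Quotient.eq (r := MulAction.orbitRel H (RealE A))
  disjoint p := by
    obtain ⟨U, hU, hU'⟩ := exists_nhds_disjoint_smul p
    exact ⟨U, hU, fun g hg => Subtype.ext (hU' g hg)⟩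

end Covering

end RealE

namespace GroupOperad

variable {G K L : ℕ → Type*} [∀ n, Group (G n)] [∀ n, Group (K n)] [∀ n, Group (L n)]

protected lemma ext {P Q : GroupOperad G} (hπ : ∀ n a, P.π n a = Q.π n a)
    (hγ : ∀ {k : ℕ} (m : Fin k → ℕ) {N : ℕ} (h : ∑ i, m i = N) (a : G k) (b : ∀ i, G (m i)),
      P.γ m h a b = Q.γ m h a b) : P = Q := by
  obtain ⟨_, π, γ, _, _, _, _, _⟩ := P
  obtain ⟨_, π', γ', _, _, _, _, _⟩ := Q
  obtain rfl : π = π' := funext fun n => MonoidHom.ext (hπ n)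
  obtain rfl : @γ = @γ' := by
    funext k m N h a b
    exact hγ m h a b
  rfl

lemma γ_one_one (𝒢 : GroupOperad G) {k : ℕ} (m : Fin k → ℕ) {N : ℕ} (h : ∑ i, m i = N) :
    𝒢.γ m h 1 (fun _ => 1) = 1 := by
  have γ_perm (p : SymGroup k) (hp : p = 1) :
      𝒢.γ (fun i => m (p.unop.symm i)) (sum_comp_perm h p.unop.symm) 1 (fun _ => 1) =
        𝒢.γ m h 1 (fun _ => 1) := by
    subst hp
    rfl
  have hcrossed := 𝒢.crossed m h 1 1 (fun _ => 1) (fun _ => 1)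
  rw [γ_perm _ (map_one _)] at hcrossed
  simp only [mul_one] at hcrossed
  exact mul_eq_left.1 hcrossed.symm

/-- Transport of the structure of a group operad along isomorphisms of groups. -/
def transport (𝒢 : GroupOperad G) (e : ∀ n, G n ≃* K n) : GroupOperad K where
  subsingleton_zero := have := 𝒢.subsingleton_zero; (e 0).symm.injective.subsingleton
  π n := (𝒢.π n).comp (e n).symm.toMonoidHom
  γ m N h a b := e N (𝒢.γ m h ((e _).symm a) fun i => (e _).symm (b i))
  assoc m M hm n n' hn N hn' hN a b c := by
    simpa using 𝒢.assoc m hm n n' hn hn' hN ((e _).symm a) (fun i => (e _).symm (b i))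
      (fun i j => (e _).symm (c i j))
  one_γ h a := by simpa [MulEquiv.eq_symm_apply] using congrArg (e _) (𝒢.one_γ h ((e _).symm a))
  γ_one h a := by simpa using congrArg (e _) (𝒢.γ_one h ((e _).symm a))
  π_γ m N h a b := by simpa using 𝒢.π_γ m h ((e _).symm a) (fun i => (e _).symm (b i))
  crossed m N h a a' b b' := by
    simp only [map_mul]
    exact (congrArg (e N) (𝒢.crossed m h _ _ _ _)).trans (map_mul _ _ _)

variable (𝒢 : GroupOperad G) (e : ∀ n, G n ≃* K n)

lemma transport_π (n : ℕ) (a : G n) : (𝒢.transport e).π n (e n a) = 𝒢.π n a := by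
  simp [transport]

lemma transport_γ {k : ℕ} (m : Fin k → ℕ) {N : ℕ} (h : ∑ i, m i = N) (a : G k)
    (b : ∀ i, G (m i)) :
    (𝒢.transport e).γ m h (e k a) (fun i => e (m i) (b i)) = e N (𝒢.γ m h a b) := by
  simp [transport]

variable {𝒢 e} in
lemma eq_transport {P : GroupOperad K} (hπ : ∀ n a, P.π n (e n a) = 𝒢.π n a)
    (hγ : ∀ {k : ℕ} (m : Fin k → ℕ) {N : ℕ} (h : ∑ i, m i = N) (a : G k) (b : ∀ i, G (m i)),
      P.γ m h (e k a) (fun i => e (m i) (b i)) = e N (𝒢.γ m h a b)) : P = 𝒢.transport e := by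
  refine GroupOperad.ext (fun n a => ?_) fun m N h a b => ?_
  · simpa [transport] using hπ n ((e n).symm a)
  · simpa [transport] using hγ m h ((e _).symm a) fun i => (e _).symm (b i)

/-- A group operad is isomorphic to its transports. -/
def transportIso : Iso 𝒢 (𝒢.transport e) where
  app n := (e n).toMonoidHom
  map_π := 𝒢.transport_π e
  map_γ m _ h a b := (𝒢.transport_γ e m h a b).symm
  bijective n := (e n).bijective

/-- The isomorphism between two transports of a group operad. -/
def transportTransportIso (e' : ∀ n, G n ≃* L n) : Iso (𝒢.transport e) (𝒢.transport e') where
  app n := ((e n).symm.trans (e' n)).toMonoidHom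
  map_π n a := 𝒢.transport_π e' n ((e n).symm a)
  map_γ m _ h a b := by
    refine Eq.trans ?_ (𝒢.transport_γ e' m h ((e _).symm a) fun i => (e _).symm (b i)).symm
    exact congrArg (e' _) ((e _).symm_apply_apply _)
  bijective n := ((e n).symm.trans (e' n)).bijective

lemma transportTransportIso_app (e' : ∀ n, G n ≃* L n) (n : ℕ) (a : G n) :
    (𝒢.transportTransportIso e e').app n (e n a) = e' n a :=
  congrArg (e' n) ((e n).symm_apply_apply a)

/-- The composition of isomorphisms of group operads. -/
def Iso.trans {𝒢 : GroupOperad G} {𝒦 : GroupOperad K} {ℒ : GroupOperad L} (f : Iso 𝒢 𝒦)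
    (g : Iso 𝒦 ℒ) : Iso 𝒢 ℒ where
  app n := (g.app n).comp (f.app n)
  map_π n a := (g.map_π n _).trans (f.map_π n a)
  map_γ m _ h a b := (congrArg (g.app _) (f.map_γ m h a b)).trans (g.map_γ m h _ _)
  bijective n := (g.bijective n).comp (f.bijective n)

/-- A group operad is isomorphic to itself as a sub group operad. -/
def wholeIso : Iso 𝒢 (SubGroupOperad.whole 𝒢).toGroupOperad where
  app n := (Subgroup.topEquiv (G := G n)).symm.toMonoidHom
  map_π _ _ := rfl
  map_γ _ _ _ _ _ := rfl
  bijective n := (Subgroup.topEquiv (G := G n)).symm.bijective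

end GroupOperad

section SimplicialPi1

variable {G G' : Type u} [Group G] [Group G'] {H : Subgroup G} {H' : Subgroup G'}

namespace EG

/-- The `1`-simplex `(e, a)` of `EG`, as an edge from `e` to `a e`. -/
def edge (a : G) : (EG G).Edge (EG.base G) ((EG.smul a).app _ (EG.base G)) :=
  SSet.Edge.mk (X := EG G) (show Fin 2 → G from ![1, a])
    (funext fun i : Fin 1 => by fin_cases i; rfl)
    (funext fun i : Fin 1 => by fin_cases i; exact (mul_one a).symm)

lemma edge_eq {a : G} (f : (EG G).Edge (EG.base G) ((EG.smul a).app _ (EG.base G))) :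
    f.edge = (edge a).edge := by
  have h₀ : (show Fin 2 → G from f.edge) 0 = 1 := congrFun f.src_eq (0 : Fin 1)
  have h₁ : (show Fin 2 → G from f.edge) 1 = a * 1 := congrFun f.tgt_eq (0 : Fin 1)
  exact funext (Fin.forall_fin_two.2 ⟨h₀, h₁.trans (mul_one a)⟩)

end EG

namespace SimplicialPi1

lemma classLabel_ofLift (a : H)
    (f : (EG G).Edge (EG.base G) ((EG.smul (a : G)).app _ (EG.base G))) :
    classLabel H (ofLift a f) = a := by
  change label H ((EGmod.proj H).app _ f.edge) = a
  rw [EG.edge_eq f]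
  change (1 : G)⁻¹ * a = a
  rw [inv_one, one_mul]

lemma classLabel_map (φ : G →* G') (hφ : ∀ a ∈ H, φ a ∈ H') (u : SimplicialPi1 H) :
    classLabel H' (map φ hφ u) = φ (classLabel H u) := by
  obtain ⟨f⟩ := u
  change label H' ((EGmod.map φ hφ).app _ f.edge) = φ (label H f.edge)
  obtain ⟨s, hs⟩ := Quotient.exists_rep (s := MulAction.orbitRel H (Fin 2 → G)) f.edge
  rw [← hs]
  change (φ (s 0))⁻¹ * φ (s 1) = φ ((s 0)⁻¹ * s 1)
  rw [map_mul, map_inv]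

variable (H) in
/-- The isomorphism `H ≅ π₁(EG/H)`: the class of the projection of `(e, a)` corresponds to `a`. -/
noncomputable def mulEquiv : H ≃* SimplicialPi1 H :=
  (MulEquiv.ofBijective (MonoidHom.mk' (fun u => (⟨classLabel H u, classLabel_mem u⟩ : H))
      fun u v => Subtype.ext (classLabel_mul u v))
    ⟨fun _ _ h => classLabel_injective (congrArg Subtype.val h), fun a =>
      (exists_class a.2).imp fun _ h => Subtype.ext h⟩).symm

lemma classLabel_mulEquiv (a : H) : classLabel H (mulEquiv H a) = a :=
  congrArg Subtype.val ((mulEquiv H).symm_apply_apply a)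

lemma ofLift_eq_mulEquiv (a : H)
    (f : (EG G).Edge (EG.base G) ((EG.smul (a : G)).app _ (EG.base G))) :
    ofLift a f = mulEquiv H a :=
  classLabel_injective ((classLabel_ofLift a f).trans (classLabel_mulEquiv a).symm)

lemma map_mulEquiv (φ : G →* G') (hφ : ∀ a ∈ H, φ a ∈ H') (a : H) :
    map φ hφ (mulEquiv H a) = mulEquiv H' ⟨φ a, hφ a a.2⟩ :=
  classLabel_injective (by rw [classLabel_map, classLabel_mulEquiv, classLabel_mulEquiv])

end SimplicialPi1

end SimplicialPi1

section RealPi1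

variable {G G' : Type u} [Group G] [Group G'] {H : Subgroup G} {H' : Subgroup G'}

namespace RealE

lemma map_base (φ : G →* G') : SSet.toTop.map (EG.map φ) (RealE.base G) = RealE.base G' := by
  rw [base_eq_vertex, base_eq_vertex, ← map_one φ]
  exact map_vertex φ 1

/-- The image in `|EG'|` of a path in `|EG|` from `e` to `a e`. -/
noncomputable def mapPath (φ : G →* G') {a : G} (f : Path (RealE.base G) (a • RealE.base G)) :
    Path (RealE.base G') (φ a • RealE.base G') :=
  (f.map (SSet.toTop.map (EG.map φ)).hom.continuous).cast (map_base φ).symm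
    ((RealE.map_smul φ a _).trans (congrArg _ (map_base φ))).symm

end RealE

namespace RealPi1

variable (H) in
/-- The isomorphism `H ≅ π₁(|EG|/H)` for the covering `|EG| → |EG|/H`, whose total space is simply
connected. -/
noncomputable def mulEquiv : H ≃* RealPi1 H :=
  ((MulEquiv.op ((RealE.isQuotientCoveringMap H).fundamentalGroupEquiv
    (x := RealEmod.base H) ⟨RealE.base G, rfl⟩)).trans (MulEquiv.opOp H).symm).symm

lemma ofLift_eq_mulEquiv (a : H) (f : Path (RealE.base G) ((a : G) • RealE.base G)) :
    ofLift a f = mulEquiv H a := by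
  rw [mulEquiv, MulEquiv.eq_symm_apply]
  have hp := RealE.isQuotientCoveringMap H
  suffices hmonodromy : hp.fundamentalGroupToMulOpposite (x := RealEmod.base H)
      ⟨RealE.base G, rfl⟩ (MulOpposite.unop (ofLift a f)) = MulOpposite.op a from
    congrArg MulOpposite.unop hmonodromy
  rw [IsQuotientCoveringMap.fundamentalGroupToMulOpposite_apply_eq_Iff]
  let endpoint : RealEmod.proj H ⁻¹' {RealEmod.base H} :=
    ⟨(a : G) • RealE.base G, (RealEmod.proj_smul_base H a).symm⟩
  exact congrArg Subtype.val (hp.isCoveringMap.monodromy_eq_of_map_eq (ex := ⟨_, rfl⟩)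
    (ey := endpoint) (γ := MulOpposite.unop (ofLift a f)) (Path.Homotopic.Quotient.mk f) rfl).symm

lemma map_ofLift (φ : G →* G') (hφ : ∀ a ∈ H, φ a ∈ H') (a : H)
    (f : Path (RealE.base G) ((a : G) • RealE.base G)) :
    map φ hφ (ofLift a f) = ofLift ⟨φ a, hφ a a.2⟩ (RealE.mapPath φ f) :=
  congrArg MulOpposite.op ((FundamentalGroup.mapOfEq_apply _ _ _).trans rfl)

lemma map_mulEquiv (φ : G →* G') (hφ : ∀ a ∈ H, φ a ∈ H') (a : H) :
    map φ hφ (mulEquiv H a) = mulEquiv H' ⟨φ a, hφ a a.2⟩ := by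
  let f : Path (RealE.base G) ((a : G) • RealE.base G) := PathConnectedSpace.somePath _ _
  rw [← ofLift_eq_mulEquiv a f, map_ofLift, ofLift_eq_mulEquiv]

end RealPi1

end RealPi1

section FundamentalGroupOperads

variable {G : ℕ → Type u} [∀ n, Group (G n)] {𝒢 : GroupOperad G} (𝓗 : SubGroupOperad 𝒢)

namespace GroupOperad

variable {k : ℕ} (m : Fin k → ℕ) {N : ℕ} (h : ∑ i, m i = N) {a : G k} {b : ∀ i, G (m i)}

lemma edge_γ (f : (EG (G k)).Edge (EG.base (G k)) ((EG.smul a).app _ (EG.base (G k))))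
    (g : ∀ i, (EG (G (m i))).Edge (EG.base (G (m i)))
      ((EG.smul (b i)).app _ (EG.base (G (m i))))) :
    (EG.edge (𝒢.γ m h a b)).edge = 𝒢.simplexγ m h f.edge (fun i => (g i).edge) := by
  rw [EG.edge_eq f, funext fun i => EG.edge_eq (g i)]
  exact funext (Fin.forall_fin_two.2 ⟨(𝒢.γ_one_one m h).symm, rfl⟩)

variable (𝒢) in
/-- The composite path `s ↦ γ(f(s); g₁(s), …, g_k(s))` in `|EG_N|` from `e` to
`γ(a; b₁, …, b_k) e`. -/
noncomputable def pathγ (f : Path (RealE.base (G k)) (a • RealE.base (G k)))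
    (g : ∀ i, Path (RealE.base (G (m i))) (b i • RealE.base (G (m i)))) :
    Path (RealE.base (G N)) (𝒢.γ m h a b • RealE.base (G N)) where
  toFun s := 𝒢.realγ m h (f s) (fun i => g i s)
  continuous_toFun := 𝒢.continuous_realγ m h f.continuous fun i => (g i).continuous
  source' := by simp only [Path.source, RealE.base_eq_vertex, realγ_vertex, γ_one_one]
  target' := by simp only [Path.target, RealE.smul_base, realγ_vertex]

end GroupOperad

lemma isSimplicialPi1Operad_iff (P : GroupOperad (fun n => SimplicialPi1 (𝓗.H n))) :
    IsSimplicialPi1Operad 𝓗 P ↔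
      P = 𝓗.toGroupOperad.transport fun n => SimplicialPi1.mulEquiv (𝓗.H n) := by
  constructor
  · intro hP
    refine GroupOperad.eq_transport (fun n a => ?_) fun m N h a b => ?_
    · rw [← SimplicialPi1.ofLift_eq_mulEquiv a (EG.edge _)]
      exact hP.π_ofLift n a _
    · obtain ⟨w, -, hw⟩ := hP.γ_ofLift m h a b (EG.edge _) fun i => EG.edge _
      simpa only [SimplicialPi1.ofLift_eq_mulEquiv] using hw
  · rintro rfl
    refine ⟨fun n a f => ?_, fun m N h a b f g => ⟨EG.edge _, GroupOperad.edge_γ m h f g, ?_⟩⟩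
    · rw [SimplicialPi1.ofLift_eq_mulEquiv]
      exact GroupOperad.transport_π _ _ _ _
    · simp only [SimplicialPi1.ofLift_eq_mulEquiv]
      exact GroupOperad.transport_γ _ _ _ _ _ _

lemma isRealPi1Operad_iff (Q : GroupOperad (fun n => RealPi1 (𝓗.H n))) :
    IsRealPi1Operad 𝓗 Q ↔ Q = 𝓗.toGroupOperad.transport fun n => RealPi1.mulEquiv (𝓗.H n) := by
  constructor
  · intro hQ
    refine GroupOperad.eq_transport (fun n a => ?_) fun m N h a b => ?_
    · rw [← RealPi1.ofLift_eq_mulEquiv a (PathConnectedSpace.somePath _ _)]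
      exact hQ.π_ofLift n a _
    · obtain ⟨w, -, hw⟩ := hQ.γ_ofLift m h a b (PathConnectedSpace.somePath _ _)
        fun i => PathConnectedSpace.somePath _ _
      simpa only [RealPi1.ofLift_eq_mulEquiv] using hw
  · rintro rfl
    refine ⟨fun n a f => ?_, fun m N h a b f g =>
      ⟨𝒢.pathγ m h f g, fun s => 𝒢.isRealγ_realγ m h (f s) fun i => g i s, ?_⟩⟩
    · rw [RealPi1.ofLift_eq_mulEquiv]
      exact GroupOperad.transport_π _ _ _ _
    · simp only [RealPi1.ofLift_eq_mulEquiv]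
      exact (GroupOperad.transport_γ _ _ _ _ _ _).trans (RealPi1.ofLift_eq_mulEquiv _ _).symm

end FundamentalGroupOperads

end

theorem mainTheorem4 :
    -- the fundamental groups operads `π₁(E𝒢/𝓗)` and `π₁(|E𝒢|/𝓗)`
    ∃ (P : ∀ {G : ℕ → Type u} [∀ n, Group (G n)] {𝒢 : GroupOperad G} (𝓗 : SubGroupOperad 𝒢),
          GroupOperad (fun n => SimplicialPi1 (𝓗.H n)))
      (Q : ∀ {G : ℕ → Type u} [∀ n, Group (G n)] {𝒢 : GroupOperad G} (𝓗 : SubGroupOperad 𝒢),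
          GroupOperad (fun n => RealPi1 (𝓗.H n))),
      (∀ {G : ℕ → Type u} [∀ n, Group (G n)] {𝒢 : GroupOperad G} (𝓗 : SubGroupOperad 𝒢),
        (∀ P', IsSimplicialPi1Operad 𝓗 P' ↔ P' = P 𝓗) ∧
        (∀ Q', IsRealPi1Operad 𝓗 Q' ↔ Q' = Q 𝓗)) ∧
      -- the isomorphisms `𝓗 ≅ π₁(E𝒢/𝓗) ≅ π₁(|E𝒢|/𝓗)`
      (∃ (Φ : ∀ {G : ℕ → Type u} [∀ n, Group (G n)] {𝒢 : GroupOperad G} (𝓗 : SubGroupOperad 𝒢),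
            GroupOperad.Iso 𝓗.toGroupOperad (P 𝓗))
        (Ψ : ∀ {G : ℕ → Type u} [∀ n, Group (G n)] {𝒢 : GroupOperad G} (𝓗 : SubGroupOperad 𝒢),
            GroupOperad.Iso (P 𝓗) (Q 𝓗)),
        -- naturality in the pair `(𝒢, 𝓗)`
        ∀ {G : ℕ → Type u} [∀ n, Group (G n)] {𝒢 : GroupOperad G} (𝓗 : SubGroupOperad 𝒢)
          {G' : ℕ → Type u} [∀ n, Group (G' n)] {𝒢' : GroupOperad G'} (𝓗' : SubGroupOperad 𝒢')
          (ψ : GroupOperad.Hom 𝒢 𝒢') (hψ : ψ.MapsPair 𝓗 𝓗') (n : ℕ),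
          (∀ a : 𝓗.H n,
            SimplicialPi1.map (ψ.app n) (hψ n) ((Φ 𝓗).app n a) =
              (Φ 𝓗').app n ⟨ψ.app n a, hψ n a a.2⟩) ∧
          (∀ x : SimplicialPi1 (𝓗.H n),
            RealPi1.map (ψ.app n) (hψ n) ((Ψ 𝓗).app n x) =
              (Ψ 𝓗').app n (SimplicialPi1.map (ψ.app n) (hψ n) x))) ∧
      -- the case `𝓗 = 𝒢`
      (∀ {G : ℕ → Type u} [∀ n, Group (G n)] (𝒢 : GroupOperad G),
        Nonempty (GroupOperad.Iso 𝒢 (P (SubGroupOperad.whole 𝒢))) ∧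
        Nonempty (GroupOperad.Iso (P (SubGroupOperad.whole 𝒢)) (Q (SubGroupOperad.whole 𝒢))) ∧
        Nonempty (GroupOperad.Iso 𝒢 (Q (SubGroupOperad.whole 𝒢)))) := by
  refine ⟨fun 𝓗 => 𝓗.toGroupOperad.transport fun n => SimplicialPi1.mulEquiv (𝓗.H n),
    fun 𝓗 => 𝓗.toGroupOperad.transport fun n => RealPi1.mulEquiv (𝓗.H n),
    fun 𝓗 => ⟨isSimplicialPi1Operad_iff 𝓗, isRealPi1Operad_iff 𝓗⟩,
    ⟨fun 𝓗 => GroupOperad.transportIso _ _, fun 𝓗 => GroupOperad.transportTransportIso _ _ _,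
      fun 𝓗 _ _ _ 𝓗' ψ hψ n => ⟨SimplicialPi1.map_mulEquiv _ _, fun x => ?_⟩⟩,
    fun 𝒢 => ⟨⟨𝒢.wholeIso.trans (GroupOperad.transportIso _ _)⟩,
      ⟨GroupOperad.transportTransportIso _ _ _⟩,
      ⟨𝒢.wholeIso.trans (GroupOperad.transportIso _ _)⟩⟩⟩
  obtain ⟨a, rfl⟩ := (SimplicialPi1.mulEquiv (𝓗.H n)).surjective x
  rw [SimplicialPi1.map_mulEquiv, GroupOperad.transportTransportIso_app,
    GroupOperad.transportTransportIso_app]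
  exact RealPi1.map_mulEquiv _ _ a
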